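/- **Setting.** A rooted dipole is a loopless 2-cell embedding of a graph with exactly two vertices in an oriented closed surface, with a distinguished edge (root edge) and a distinguished vertex (root vertex), up to isomorphism; $\mathcal D$ is the set of rooted dipoles, $n(D)\ge 1$ is the number of edges and $g(D)$ the genus, so $2g(D)=n(D)-m(D)$ where $m(D)$ is the number of faces. Let $\widehat{\mathcal D}$ be the set of rooted dipoles with a further distinguished (secondary) edge, different from the root edge. For $D\in\widehat{\mathcal D}$, Region 1 is the sector at the root vertex from the root edge counterclockwise to the secondary edge, and Region 2 the complementary sector; Region 3 is the sector at the other vertex from the root edge counterclockwise to the secondary edge, and Region 4 the complementary sector. Among the remaining edges, let $\alpha(D),\beta(D),\gamma(D),\delta(D)$ be the numbers of those whose ends lie in Regions $(2,3)$, $(1,3)$, $(2,4)$, $(1,4)$, respectively. Mark the corners at the root vertex with $\bullet$ in Region 1 and with $\circ$ in Region 2. The root corner is the corner at the root vertex following the root edge counterclockwise, and the root face is the face containing it. Let $R(D)\in\{\bullet,\circ\}^*$ be the word of marks read on the counterclockwise boundary walk of the root face from the root corner, and let $\Lambda(D)$ be the multiset of cyclic words of marks read around the non-root faces. Let $g_R$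 ($R$ a binary string) and $f_{(S)}$ ($(S)$ a binary string up to cyclic shift) be indeterminates, and write $f_\Lambda=\prod_{(S)\in\Lambda}f_{(S)}$. Define the $(a,b,0,0)$-dipole series $$B=\sum_{D\in\widehat{\mathcal D},\ \gamma(D)=\delta(D)=0}\frac{x^{\alpha(D)+1}}{(\alpha(D)+1)!}\,\frac{y^{\beta(D)}}{\beta(D)!}\,u^{2g(D)}\,g_{R(D)}\,f_{\Lambda(D)},\qquad B^{(2)}=[u^4]B .$$ For $D\in\mathcal D$ with face-degree sequence $(2\lambda_1,\dots,2\lambda_m)$ put $f_{\lambda(D)}=\prod_i f_{(\circ^{\lambda_i})}$, and let $\psi_\lambda$ be the number of rooted dipoles with face-degree sequence $2\lambda$. For $k\ge0$ let $$\phi_k(y)=\sum_{n\ge k}h_{n-k}(\underbrace{f_{(\bullet)},\dots,f_{(\bullet)}}_{k})\frac{y^n}{n!},$$ where $h_j$ is the complete symmetric function of degree $j$ in $k$ variables (so $\phi_0=1$), and let $$C'=\sum_{R}\Bigl(\sum_{2\le i\le \ell(R)}g_{R_1\cdots R_i}\,f_{(R_1R_{i+1}\cdots R_{\ell(R)})}\Bigr)\frac{\partial}{\partial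 g_R}.$$ For a binary string $R$ and $k\ge0$ let $\tau_{R,k}$ be the unique power series in $y$ (with coefficients polynomials in the $g$'s and $f$'s) such that $$\Bigl(\frac{\partial}{\partial y}-C'\Bigr)\tau_{R,k}=g_{\bullet R}\,\phi_k(y),\qquad \tau_{R,k}|_{y=0}=0 .$$ **Lemma.** The generating series for $(a,b,0,0)$-dipoles on the double torus is $$\begin{aligned} B^{(2)}={}& x\exp(xf_{(\circ)})\bigl(\tau_{\bullet\circ\bullet\bullet,2}+x\,\tau_{\bullet\circ\bullet\circ,1}+2f_{(\bullet\circ)}\tau_{\bullet\bullet\bullet,3}+\tau_{\bullet\bullet\bullet\circ,2}+\tau_{\bullet\bullet\circ\bullet,2}+x f_{(\bullet\circ)}\tau_{\bullet\bullet\circ,2}\bigr)\\ &+3\,\tau_{\bullet\circ\circ\circ,0}\sum_{n\ge3}\frac{x^n}{n!}\psi_{(3,1^{n-3})}f_{(\circ)}^{n-3} +\tau_{\bullet\circ,0}\,f_{(\circ\circ\circ)}\sum_{n\ge4}\frac{(n-3)x^n}{n!}\psi_{(3,1^{n-3})}f_{(\circ)}^{n-4}\\ &+4\,\tau_{\bullet\circ\circ,0}\,f_{(\circ\circ)}\sum_{n\ge4}\frac{x^n}{n!}\psi_{(2^2,1^{n-4})}f_{(\circ)}^{n-4}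 +\tau_{\bullet\circ,0}\,f_{(\circ\circ)}^2\sum_{n\ge5}\frac{(n-4)x^n}{n!}\psi_{(2^2,1^{n-4})}f_{(\circ)}^{n-5}\\ &+[u^4]\,g_\bullet\sum_{D\in\mathcal D}\frac{x^{n(D)}}{n(D)!}u^{2g(D)}f_{\lambda(D)} . \end{aligned}$$ -/

import Mathlib

namespace DipoleSeries

open Equiv

/-! ### Faces of a rotation system, read as words -/

section Words

variable {n : ℕ}

/-- The number of steps from `r` to `e` in the cyclic order `σ`. -/
noncomputable def position (σ : Perm (Fin n)) (r e : Fin n) : ℕ :=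
  sInf {k | (σ ^ k) r = e}

/-- The marks `m x, m (φ x), m (φ² x), …` read once around the cycle of `φ` through `x`. -/
noncomputable def word (φ : Perm (Fin n)) (m : Fin n → Bool) (x : Fin n) : List Bool :=
  (List.range (Function.minimalPeriod φ x)).map fun i => m ((φ ^ i) x)

/-- The set of cycles of `φ` (fixed points included). -/
abbrev Cycles (φ : Perm (Fin n)) : Type := Quotient (Perm.SameCycle.setoid φ)

noncomputable instance (φ : Perm (Fin n)) : Fintype (Cycles φ) := Fintype.ofFinite _

theorem minimalPeriod_pos (φ : Perm (Fin n)) (x : Fin n) :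
    0 < Function.minimalPeriod φ x :=
  Function.minimalPeriod_pos_of_mem_periodicPts
    (Function.Injective.mem_periodicPts φ.injective x)

theorem word_apply (φ : Perm (Fin n)) (m : Fin n → Bool) (x : Fin n) :
    word φ m (φ x) = (word φ m x).rotate 1 := by
  have hp : Function.minimalPeriod φ (φ x) = Function.minimalPeriod φ x :=
    Function.minimalPeriod_apply (Function.Injective.mem_periodicPts φ.injective x)
  obtain ⟨p, hpp⟩ : ∃ p, Function.minimalPeriod φ x = p + 1 :=
    ⟨_, (Nat.succ_pred_eq_of_pos (minimalPeriod_pos φ x)).symm⟩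
  have hper : (φ ^ (p + 1)) x = x := by
    have := Function.iterate_minimalPeriod (f := φ) (x := x)
    rw [hpp] at this
    rwa [← Perm.iterate_eq_pow]
  unfold word
  rw [hp, hpp]
  conv_rhs => rw [List.range_succ_eq_map]
  rw [List.range_succ]
  simp only [List.map_append, List.map_cons, List.map_nil, List.map_map, List.rotate_cons_succ,
    List.rotate_zero]
  congr 1
  rw [← Perm.mul_apply, ← pow_succ, hper]
  simp

theorem word_isRotated (φ : Perm (Fin n)) (m : Fin n → Bool) {x y : Fin n}
    (h : φ.SameCycle x y) : (word φ m x : Cycle Bool) = (word φ m y : Cycle Bool) := by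
  obtain ⟨k, rfl⟩ := Perm.SameCycle.exists_nat_pow_eq h
  induction k with
  | zero => simp
  | succ k ih =>
    rw [ih ((Perm.sameCycle_pow_right (n := k)).2 (Perm.SameCycle.refl φ x)), pow_succ',
      Perm.mul_apply, word_apply]
    exact Cycle.coe_eq_coe.2 ⟨1, rfl⟩

/-- The cyclic word read around a cycle of `φ`. -/
noncomputable def cyclicWord (φ : Perm (Fin n)) (m : Fin n → Bool) :
    Cycles φ → Cycle Bool :=
  Quotient.lift (fun x => (word φ m x : Cycle Bool)) fun _ _ h => word_isRotated φ m h

theorem conj_pow_apply (π φ : Perm (Fin n)) (k : ℕ) (x : Fin n) :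
    ((π * φ * π⁻¹) ^ k) (π x) = π ((φ ^ k) x) := by
  rw [conj_pow]; simp

theorem position_conj (π σ : Perm (Fin n)) (r e : Fin n) :
    position (π * σ * π⁻¹) (π r) (π e) = position σ r e := by
  unfold position
  simp only [conj_pow_apply, π.injective.eq_iff]

theorem minimalPeriod_conj (π φ : Perm (Fin n)) (x : Fin n) :
    Function.minimalPeriod (π * φ * π⁻¹ : Perm (Fin n)) (π x) = Function.minimalPeriod φ x := by
  apply Function.minimalPeriod_eq_minimalPeriod_iff.2
  intro k
  unfold Function.IsPeriodicPt Function.IsFixedPt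
  rw [Perm.iterate_eq_pow, Perm.iterate_eq_pow, conj_pow_apply, π.injective.eq_iff]

theorem word_conj (π φ : Perm (Fin n)) {m m' : Fin n → Bool} (h : ∀ x, m' (π x) = m x)
    (x : Fin n) : word (π * φ * π⁻¹) m' (π x) = word φ m x := by
  unfold word
  rw [minimalPeriod_conj]
  simp only [conj_pow_apply, h]

/-- Relabelling by `π` carries the cycles of `φ` to those of `π φ π⁻¹`. -/
def cyclesConj (π φ : Perm (Fin n)) : Cycles φ ≃ Cycles (π * φ * π⁻¹) :=
  Quotient.congr π fun a b => by
    change φ.SameCycle a b ↔ (π * φ * π⁻¹).SameCycle (π a) (π b)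
    rw [Perm.sameCycle_conj]; simp

theorem cyclicWord_conj (π φ : Perm (Fin n)) {m m' : Fin n → Bool} (h : ∀ x, m' (π x) = m x)
    (c : Cycles φ) : cyclicWord (π * φ * π⁻¹) m' (cyclesConj π φ c) = cyclicWord φ m c := by
  induction c using Quotient.inductionOn with
  | h x => exact congrArg _ (word_conj π φ h x)

end Words

/-! ### Rooted dipoles -/

/-- A rooted loopless dipole in an orientable surface, as a rotation system with labelled edges:
`rootRot` and `otherRot` are the counterclockwise cyclic orders of the edges around the root
vertex and around the other vertex. -/
@[ext]
structure LabelledDipole (n : ℕ) where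
  rootRot : Perm (Fin n)
  otherRot : Perm (Fin n)
  rootRot_cycle : rootRot.IsCycleOn Set.univ
  otherRot_cycle : otherRot.IsCycleOn Set.univ
  root : Fin n

/-- A rooted dipole together with a secondary edge. -/
@[ext]
structure LabelledBirootedDipole (n : ℕ) extends LabelledDipole n where
  secondary : Fin n
  secondary_ne : secondary ≠ root

theorem isCycleOn_conj {n : ℕ} (π : Perm (Fin n)) {σ : Perm (Fin n)}
    (h : σ.IsCycleOn Set.univ) : (π * σ * π⁻¹).IsCycleOn Set.univ := by
  have := h.conj (g := π)
  rwa [Set.image_univ, π.surjective.range_eq] at this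

namespace LabelledDipole

variable {n : ℕ}

instance : Finite (LabelledDipole n) :=
  Finite.of_injective (fun D => (D.rootRot, D.otherRot, D.root)) fun D E h => by
    simp only [Prod.mk.injEq] at h
    exact LabelledDipole.ext h.1 h.2.1 h.2.2

/-- Permutations act by relabelling the edges. -/
instance : MulAction (Perm (Fin n)) (LabelledDipole n) where
  smul π D :=
    { rootRot := π * D.rootRot * π⁻¹
      otherRot := π * D.otherRot * π⁻¹
      rootRot_cycle := isCycleOn_conj π D.rootRot_cycle
      otherRot_cycle := isCycleOn_conj π D.otherRot_cycle
      root := π D.root }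
  one_smul D := LabelledDipole.ext (by change 1 * _ * _ = _; simp)
    (by change 1 * _ * _ = _; simp) rfl
  mul_smul π ρ D := LabelledDipole.ext (by change (π * ρ) * _ * _ = π * (ρ * _ * _) * _; group)
    (by change (π * ρ) * _ * _ = π * (ρ * _ * _) * _; group) rfl

/-- A corner at the root vertex is named by the edge `d` such that it lies between `d` and the
edge following `d` counterclockwise. The counterclockwise boundary walk of a face (face on the
left) leaves this corner along `d`, leaves the other vertex along `otherRot⁻¹ d`, and comes back
to the root vertex in the corner named `rootRot⁻¹ (otherRot⁻¹ d)`. -/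
def facePerm (D : LabelledDipole n) : Perm (Fin n) := D.rootRot⁻¹ * D.otherRot⁻¹

/-- The faces, as sets of corners at the root vertex; a face of degree `2i` has `i` of them. -/
abbrev Faces (D : LabelledDipole n) : Type := Cycles D.facePerm

/-- The root face contains the corner following the root edge counterclockwise. -/
def rootFace (D : LabelledDipole n) : D.Faces := Quotient.mk _ D.root

/-- Twice the genus: `2 - 2g = 2 - n + m` where `m` is the number of faces. -/
noncomputable def twiceGenus (D : LabelledDipole n) : ℕ := n - Fintype.card D.Faces

/-- The cyclic words `∘^{λ₁}, ∘^{λ₂}, …` (`∘` is `false`) where `2λ₁, 2λ₂, …` are the degrees of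
all the faces. -/
noncomputable def whiteWords (D : LabelledDipole n) : Multiset (Cycle Bool) :=
  (Finset.univ : Finset D.Faces).val.map (cyclicWord D.facePerm fun _ => false)

theorem facePerm_smul (π : Perm (Fin n)) (D : LabelledDipole n) :
    (π • D).facePerm = π * D.facePerm * π⁻¹ := by
  change (π * D.rootRot * π⁻¹)⁻¹ * (π * D.otherRot * π⁻¹)⁻¹ = π * (_ * _) * π⁻¹
  group

theorem map_cyclicWord_conj (π φ : Perm (Fin n)) {m m' : Fin n → Bool}
    (h : ∀ x, m' (π x) = m x) :
    (Finset.univ : Finset (Cycles (π * φ * π⁻¹))).val.map (cyclicWord _ m') =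
      (Finset.univ : Finset (Cycles φ)).val.map (cyclicWord _ m) := by
  rw [← Finset.map_univ_equiv (cyclesConj π φ), Finset.map_val, Multiset.map_map]
  exact Multiset.map_congr rfl fun c _ => cyclicWord_conj π φ h c

theorem twiceGenus_smul (π : Perm (Fin n)) (D : LabelledDipole n) :
    (π • D).twiceGenus = D.twiceGenus := by
  unfold twiceGenus Faces
  rw [facePerm_smul, Fintype.card_congr (cyclesConj π D.facePerm)]

theorem whiteWords_smul (π : Perm (Fin n)) (D : LabelledDipole n) :
    (π • D).whiteWords = D.whiteWords := by
  unfold whiteWords Faces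
  rw [facePerm_smul]
  exact map_cyclicWord_conj π _ fun _ => rfl

end LabelledDipole

/-- The rooted dipoles with `n` edges: isomorphism classes of rotation systems. -/
abbrev RootedDipole (n : ℕ) : Type :=
  MulAction.orbitRel.Quotient (Perm (Fin n)) (LabelledDipole n)

noncomputable instance (n : ℕ) : Fintype (RootedDipole n) := Fintype.ofFinite _

namespace RootedDipole

variable {n : ℕ}

noncomputable def twiceGenus : RootedDipole n → ℕ :=
  Quotient.lift LabelledDipole.twiceGenus fun _ E h => by
    obtain ⟨π, rfl⟩ := h
    exact E.twiceGenus_smul π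

noncomputable def whiteWords : RootedDipole n → Multiset (Cycle Bool) :=
  Quotient.lift LabelledDipole.whiteWords fun _ E h => by
    obtain ⟨π, rfl⟩ := h
    exact E.whiteWords_smul π

/-- Half the face-degree sequence. -/
noncomputable def halfFaceDegrees (D : RootedDipole n) : Multiset ℕ :=
  D.whiteWords.map Cycle.length

end RootedDipole

/-! ### Dipoles with a secondary edge -/

namespace LabelledBirootedDipole

variable {n : ℕ}

instance : Finite (LabelledBirootedDipole n) :=
  Finite.of_injective (fun D => (D.toLabelledDipole, D.secondary)) fun D E h => by
    simp only [Prod.mk.injEq] at h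
    cases D; cases E; simp_all

instance : MulAction (Perm (Fin n)) (LabelledBirootedDipole n) where
  smul π D :=
    { toLabelledDipole := π • D.toLabelledDipole
      secondary := π D.secondary
      secondary_ne := fun h => D.secondary_ne (π.injective h) }
  one_smul D := by
    change LabelledBirootedDipole.mk ((1 : Perm (Fin n)) • D.toLabelledDipole) _ _ = D
    cases D; simp
  mul_smul π ρ D := by
    change LabelledBirootedDipole.mk ((π * ρ) • D.toLabelledDipole) _ _ =
      LabelledBirootedDipole.mk (π • ρ • D.toLabelledDipole) _ _
    simp only [mul_smul, Perm.mul_apply]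
    rfl

/-- Steps from the root edge to `e`, counterclockwise around the root vertex. -/
noncomputable def rootPos (D : LabelledBirootedDipole n) (e : Fin n) : ℕ :=
  position D.rootRot D.root e

/-- Steps from the root edge to `e`, counterclockwise around the other vertex. -/
noncomputable def otherPos (D : LabelledBirootedDipole n) (e : Fin n) : ℕ :=
  position D.otherRot D.root e

/-- At the root vertex, Region 1 is the sector from the root edge counterclockwise to the
secondary edge, and Region 2 is the rest. -/
def InRegion1 (D : LabelledBirootedDipole n) (e : Fin n) : Prop :=
  0 < D.rootPos e ∧ D.rootPos e < D.rootPos D.secondary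

def InRegion2 (D : LabelledBirootedDipole n) (e : Fin n) : Prop :=
  D.rootPos D.secondary < D.rootPos e

/-- At the other vertex, Region 3 is the sector from the root edge counterclockwise to the
secondary edge, and Region 4 is the rest. -/
def InRegion3 (D : LabelledBirootedDipole n) (e : Fin n) : Prop :=
  0 < D.otherPos e ∧ D.otherPos e < D.otherPos D.secondary

def InRegion4 (D : LabelledBirootedDipole n) (e : Fin n) : Prop :=
  D.otherPos D.secondary < D.otherPos e

/-- The numbers of `a`-, `b`-, `c`- and `d`-edges. -/
noncomputable def alpha (D : LabelledBirootedDipole n) : ℕ :=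
  Nat.card {e // D.InRegion2 e ∧ D.InRegion3 e}

noncomputable def beta (D : LabelledBirootedDipole n) : ℕ :=
  Nat.card {e // D.InRegion1 e ∧ D.InRegion3 e}

noncomputable def gamma (D : LabelledBirootedDipole n) : ℕ :=
  Nat.card {e // D.InRegion2 e ∧ D.InRegion4 e}

noncomputable def delta (D : LabelledBirootedDipole n) : ℕ :=
  Nat.card {e // D.InRegion1 e ∧ D.InRegion4 e}

open Classical in
/-- The mark of the corner between `d` and the next edge counterclockwise at the root vertex:
black (`true`) in Region 1, white (`false`) in Region 2. -/
noncomputable def mark (D : LabelledBirootedDipole n) (d : Fin n) : Bool :=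
  decide (D.rootPos d < D.rootPos D.secondary)

/-- The word `R(D)` of the root face, read from the root corner. -/
noncomputable def rootWord (D : LabelledBirootedDipole n) : List Bool :=
  word D.facePerm D.mark D.root

open Classical in
/-- The multiset `Λ(D)` of the cyclic words of the non-root faces. -/
noncomputable def nonrootWords (D : LabelledBirootedDipole n) : Multiset (Cycle Bool) :=
  ((Finset.univ : Finset D.Faces).erase D.rootFace).val.map (cyclicWord D.facePerm D.mark)

theorem rootPos_smul (π : Perm (Fin n)) (D : LabelledBirootedDipole n) (e : Fin n) :
    (π • D).rootPos (π e) = D.rootPos e := position_conj π D.rootRot D.root e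

theorem otherPos_smul (π : Perm (Fin n)) (D : LabelledBirootedDipole n) (e : Fin n) :
    (π • D).otherPos (π e) = D.otherPos e := position_conj π D.otherRot D.root e

theorem rootPos_secondary_smul (π : Perm (Fin n)) (D : LabelledBirootedDipole n) :
    (π • D).rootPos (π • D).secondary = D.rootPos D.secondary := D.rootPos_smul π _

theorem otherPos_secondary_smul (π : Perm (Fin n)) (D : LabelledBirootedDipole n) :
    (π • D).otherPos (π • D).secondary = D.otherPos D.secondary := D.otherPos_smul π _

theorem alpha_smul (π : Perm (Fin n)) (D : LabelledBirootedDipole n) :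
    (π • D).alpha = D.alpha := (Nat.card_congr (π.subtypeEquiv fun e => by
      simp only [InRegion2, InRegion3, rootPos_smul, otherPos_smul, rootPos_secondary_smul,
        otherPos_secondary_smul])).symm

theorem beta_smul (π : Perm (Fin n)) (D : LabelledBirootedDipole n) :
    (π • D).beta = D.beta := (Nat.card_congr (π.subtypeEquiv fun e => by
      simp only [InRegion1, InRegion3, rootPos_smul, otherPos_smul, rootPos_secondary_smul,
        otherPos_secondary_smul])).symm

theorem gamma_smul (π : Perm (Fin n)) (D : LabelledBirootedDipole n) :
    (π • D).gamma = D.gamma := (Nat.card_congr (π.subtypeEquiv fun e => by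
      simp only [InRegion2, InRegion4, rootPos_smul, otherPos_smul, rootPos_secondary_smul,
        otherPos_secondary_smul])).symm

theorem delta_smul (π : Perm (Fin n)) (D : LabelledBirootedDipole n) :
    (π • D).delta = D.delta := (Nat.card_congr (π.subtypeEquiv fun e => by
      simp only [InRegion1, InRegion4, rootPos_smul, otherPos_smul, rootPos_secondary_smul,
        otherPos_secondary_smul])).symm

theorem mark_smul (π : Perm (Fin n)) (D : LabelledBirootedDipole n) (d : Fin n) :
    (π • D).mark (π d) = D.mark d := by
  simp only [mark, rootPos_smul, rootPos_secondary_smul]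

theorem facePerm_smul (π : Perm (Fin n)) (D : LabelledBirootedDipole n) :
    (π • D).facePerm = π * D.facePerm * π⁻¹ := D.toLabelledDipole.facePerm_smul π

theorem rootWord_smul (π : Perm (Fin n)) (D : LabelledBirootedDipole n) :
    (π • D).rootWord = D.rootWord := by
  unfold rootWord
  rw [facePerm_smul]
  exact word_conj π _ (D.mark_smul π) _

open Classical in
theorem map_erase_conj (π φ : Perm (Fin n)) {m m' : Fin n → Bool}
    (h : ∀ x, m' (π x) = m x) (r : Fin n) :
    ((Finset.univ : Finset (Cycles (π * φ * π⁻¹))).erase (Quotient.mk _ (π r))).val.map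
        (cyclicWord _ m') =
      ((Finset.univ : Finset (Cycles φ)).erase (Quotient.mk _ r)).val.map (cyclicWord _ m) := by
  have : (Quotient.mk _ (π r) : Cycles (π * φ * π⁻¹)) = cyclesConj π φ (Quotient.mk _ r) := rfl
  rw [this, ← Finset.map_univ_equiv (cyclesConj π φ)]
  change ((Finset.map _ _).erase ((cyclesConj π φ).toEmbedding _)).val.map _ = _
  rw [← Finset.map_erase, Finset.map_val, Multiset.map_map]
  exact Multiset.map_congr rfl fun c _ => cyclicWord_conj π φ h c

theorem nonrootWords_smul (π : Perm (Fin n)) (D : LabelledBirootedDipole n) :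
    (π • D).nonrootWords = D.nonrootWords := by
  classical
  have key : ∀ (ψ : Perm (Fin n)), ψ = π * D.facePerm * π⁻¹ →
      ((Finset.univ : Finset (Cycles ψ)).erase (Quotient.mk _ (π D.root))).val.map
        (cyclicWord ψ (π • D).mark) = D.nonrootWords := by
    rintro ψ rfl
    unfold nonrootWords LabelledDipole.rootFace LabelledDipole.Faces
    convert map_erase_conj π D.facePerm (D.mark_smul π) D.root
  rw [← key _ (D.facePerm_smul π)]
  unfold nonrootWords LabelledDipole.rootFace LabelledDipole.Faces
  congr!

end LabelledBirootedDipole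

/-! The four edge types and the two distinguished edges exhaust the edges. -/

theorem exists_pow_apply {n : ℕ} {σ : Perm (Fin n)} (h : σ.IsCycleOn Set.univ) (r e : Fin n) :
    (σ ^ position σ r e) r = e := by
  refine Nat.sInf_mem (s := {k | (σ ^ k) r = e}) ?_
  exact Perm.SameCycle.exists_nat_pow_eq (h.2 (Set.mem_univ r) (Set.mem_univ e))

theorem position_inj {n : ℕ} {σ : Perm (Fin n)} (h : σ.IsCycleOn Set.univ) (r : Fin n)
    {e e' : Fin n} : position σ r e = position σ r e' ↔ e = e' :=
  ⟨fun hp => by rw [← exists_pow_apply h r e, hp, exists_pow_apply h], fun hp => by rw [hp]⟩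

theorem position_eq_zero {n : ℕ} {σ : Perm (Fin n)} (h : σ.IsCycleOn Set.univ) {r e : Fin n} :
    position σ r e = 0 ↔ e = r := by
  have : position σ r r = 0 := Nat.sInf_eq_zero.2 (Or.inl (by simp))
  rw [← this, position_inj h]

theorem region_count {p q r s : ℕ} (a1 : p = 0 ↔ q = 0) (a2 : p = r ↔ q = s) (a3 : r ≠ 0)
    (a4 : s ≠ 0) : (1 : ℕ) =
      (if r < p ∧ 0 < q ∧ q < s then 1 else 0) +
      (if (0 < p ∧ p < r) ∧ 0 < q ∧ q < s then 1 else 0) +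
      (if r < p ∧ s < q then 1 else 0) + (if (0 < p ∧ p < r) ∧ s < q then 1 else 0) +
      (if p = 0 then 1 else 0) + (if p = r then 1 else 0) := by
  split <;> split <;> split <;> split <;> split <;> split <;> omega

theorem LabelledBirootedDipole.card_edges {n : ℕ} (D : LabelledBirootedDipole n) :
    D.alpha + D.beta + D.gamma + D.delta + 2 = n := by
  classical
  have h0 : ∀ e, D.rootPos e = 0 ↔ e = D.root := fun e => position_eq_zero D.rootRot_cycle
  have h0' : ∀ e, D.otherPos e = 0 ↔ e = D.root := fun e => position_eq_zero D.otherRot_cycle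
  have hs : ∀ e, D.rootPos e = D.rootPos D.secondary ↔ e = D.secondary :=
    fun e => position_inj D.rootRot_cycle D.root
  have hs' : ∀ e, D.otherPos e = D.otherPos D.secondary ↔ e = D.secondary :=
    fun e => position_inj D.otherRot_cycle D.root
  have hne := D.secondary_ne
  have hsum : ∀ e : Fin n, (1 : ℕ) =
      (if D.InRegion2 e ∧ D.InRegion3 e then 1 else 0) +
      (if D.InRegion1 e ∧ D.InRegion3 e then 1 else 0) +
      (if D.InRegion2 e ∧ D.InRegion4 e then 1 else 0) +
      (if D.InRegion1 e ∧ D.InRegion4 e then 1 else 0) +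
      (if e = D.root then 1 else 0) + (if e = D.secondary then 1 else 0) := by
    intro e
    have a1 : D.rootPos e = 0 ↔ D.otherPos e = 0 := (h0 e).trans (h0' e).symm
    have a2 : D.rootPos e = D.rootPos D.secondary ↔ D.otherPos e = D.otherPos D.secondary :=
      (hs e).trans (hs' e).symm
    have a3 : D.rootPos D.secondary ≠ 0 := fun h => hne ((h0 _).1 h)
    have a4 : D.otherPos D.secondary ≠ 0 := fun h => hne ((h0' _).1 h)
    simp only [InRegion1, InRegion2, InRegion3, InRegion4, ← h0 e, ← hs e]
    exact (region_count a1 a2 a3 a4).trans (by congr)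
  have := Finset.sum_congr (rfl : (Finset.univ : Finset (Fin n)) = _) fun e _ => hsum e
  simp only [Finset.sum_add_distrib, ← Finset.card_filter, Finset.sum_const, Finset.card_univ,
    Fintype.card_fin, smul_eq_mul, mul_one] at this
  simp only [Finset.filter_eq', Finset.mem_univ, if_true, Finset.card_singleton] at this
  simp only [alpha, beta, gamma, delta, Nat.card_eq_fintype_card, Fintype.card_subtype]
  omega

/-- The dipoles with `n` edges, a root and a secondary edge: isomorphism classes. -/
abbrev BirootedDipole (n : ℕ) : Type :=
  MulAction.orbitRel.Quotient (Perm (Fin n)) (LabelledBirootedDipole n)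

noncomputable instance (n : ℕ) : Fintype (BirootedDipole n) := Fintype.ofFinite _

namespace BirootedDipole

variable {n : ℕ}

noncomputable def twiceGenus : BirootedDipole n → ℕ :=
  Quotient.lift (fun D => D.toLabelledDipole.twiceGenus) fun _ E h => by
    obtain ⟨π, rfl⟩ := h
    exact E.toLabelledDipole.twiceGenus_smul π

noncomputable def alpha : BirootedDipole n → ℕ :=
  Quotient.lift LabelledBirootedDipole.alpha fun _ E h => by
    obtain ⟨π, rfl⟩ := h
    exact E.alpha_smul π

noncomputable def beta : BirootedDipole n → ℕ :=
  Quotient.lift LabelledBirootedDipole.beta fun _ E h => by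
    obtain ⟨π, rfl⟩ := h
    exact E.beta_smul π

noncomputable def gamma : BirootedDipole n → ℕ :=
  Quotient.lift LabelledBirootedDipole.gamma fun _ E h => by
    obtain ⟨π, rfl⟩ := h
    exact E.gamma_smul π

noncomputable def delta : BirootedDipole n → ℕ :=
  Quotient.lift LabelledBirootedDipole.delta fun _ E h => by
    obtain ⟨π, rfl⟩ := h
    exact E.delta_smul π

noncomputable def rootWord : BirootedDipole n → List Bool :=
  Quotient.lift LabelledBirootedDipole.rootWord fun _ E h => by
    obtain ⟨π, rfl⟩ := h
    exact E.rootWord_smul π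

noncomputable def nonrootWords : BirootedDipole n → Multiset (Cycle Bool) :=
  Quotient.lift LabelledBirootedDipole.nonrootWords fun _ E h => by
    obtain ⟨π, rfl⟩ := h
    exact E.nonrootWords_smul π

theorem card_edges (D : BirootedDipole n) : D.alpha + D.beta + D.gamma + D.delta + 2 = n := by
  induction D using Quotient.inductionOn with
  | h D => exact D.card_edges

end BirootedDipole

/-! ### Rings of series -/

/-- Polynomials over `ℚ` in the indeterminates `g_R` (`R` a binary string) and `f_(S)` (`(S)` a
cyclic binary string). -/
abbrev Coeffs : Type := MvPolynomial (List Bool ⊕ Cycle Bool) ℚ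

/-- Series in `y`. -/
abbrev SeriesY : Type := PowerSeries Coeffs

/-- Series in `x` and `y`. -/
abbrev SeriesXY : Type := PowerSeries SeriesY

/-- Series in `u`, `x` and `y`. -/
abbrev SeriesUXY : Type := PowerSeries SeriesXY

/-- The black dot. -/
abbrev bl : Bool := true

/-- The white dot. -/
abbrev wh : Bool := false

noncomputable def gVar (R : List Bool) : Coeffs := MvPolynomial.X (Sum.inl R)

noncomputable def fVar (S : Cycle Bool) : Coeffs := MvPolynomial.X (Sum.inr S)

noncomputable def fMonomial (L : Multiset (Cycle Bool)) : Coeffs := (L.map fVar).prod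

open Classical in
/-- The series
`A = g_• ∑_D x^{n(D)} / n(D)! u^{2g(D)} f_{λ(D)}` over all rooted dipoles `D`. -/
noncomputable def seriesA : SeriesUXY :=
  PowerSeries.mk fun k => PowerSeries.mk fun n => PowerSeries.C
    ((1 / (n.factorial : ℚ)) • (gVar [bl] *
      ∑ D : RootedDipole n with D.twiceGenus = k, fMonomial D.whiteWords))

open Classical in
/-- The `(a,b,0,0)`-dipole series: the sum of
`x^{α+1}/(α+1)! y^β/β! u^{2g} g_R f_Λ` over all dipoles with a root and a secondary edge for which
`γ = δ = 0`. Such a dipole has `α + β + 2` edges, so the coefficient of `u^k x^i y^j` only involves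
dipoles with `i + j + 1` edges. -/
noncomputable def seriesB : SeriesUXY :=
  PowerSeries.mk fun k => PowerSeries.mk fun i => PowerSeries.mk fun j =>
    (1 / ((i.factorial : ℚ) * (j.factorial : ℚ))) •
      ∑ D : BirootedDipole (i + j + 1) with
        D.gamma = 0 ∧ D.delta = 0 ∧ D.alpha + 1 = i ∧ D.beta = j ∧ D.twiceGenus = k,
        gVar D.rootWord * fMonomial D.nonrootWords

/-- The number of rooted dipoles with `n` edges and face-degree sequence `2λ`. -/
noncomputable def psi (n : ℕ) (lam : Multiset ℕ) : ℕ :=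
  Nat.card {D : RootedDipole n // D.halfFaceDegrees = lam}

/-! ### The functions `φ_k` and `τ_{R,k}` -/

/-- `φ(y, x_1, …, x_i) = ∑_{n ≥ i} h_{n-i}(x_1, …, x_i) y^n / n!`, where `h_j` is the complete
symmetric function; for `i = 0` this is `1`. -/
noncomputable def phiGeneral {i : ℕ} (v : Fin i → Coeffs) : SeriesY :=
  PowerSeries.mk fun n =>
    if i ≤ n then
      (1 / (n.factorial : ℚ)) • MvPolynomial.aeval v (MvPolynomial.hsymm (Fin i) ℚ (n - i))
    else 0

/-- `φ_i(y)`: all the `x_j` are `f_(•)`. -/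
noncomputable def phi (i : ℕ) : SeriesY := phiGeneral fun _ : Fin i => fVar ([bl] : List Bool)

/-- The operator
`C' = ∑_R (∑_{2 ≤ i ≤ ℓ(R)} g_{R_1 ⋯ R_i} f_{(R_1 R_{i+1} ⋯ R_{ℓ(R)})}) ∂/∂g_R`. -/
noncomputable def cut : Derivation ℚ Coeffs Coeffs :=
  MvPolynomial.mkDerivation ℚ (Sum.elim
    (fun R => ∑ i ∈ Finset.Icc 2 R.length,
      gVar (R.take i) * fVar ((R.take 1 ++ R.drop i : List Bool) : Cycle Bool))
    (fun _ => 0))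

/-- `C'` on series in `y`, coefficientwise. -/
noncomputable def cutY (F : SeriesY) : SeriesY :=
  PowerSeries.mk fun n => cut (PowerSeries.coeff n F)

/-- The equation `(∂/∂y - C') T = G`, with `T = 0` at `y = 0`. -/
def IsPreimage (G T : SeriesY) : Prop :=
  PowerSeries.derivative Coeffs T - cutY T = G ∧ PowerSeries.constantCoeff T = 0

theorem existsUnique_isPreimage (G : SeriesY) : ∃! T, IsPreimage G T := by
  have key : ∀ T : SeriesY, IsPreimage G T ↔ PowerSeries.coeff 0 T = 0 ∧
      ∀ n : ℕ, PowerSeries.coeff (n + 1) T =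
        (1 / ((n : ℚ) + 1)) • (PowerSeries.coeff n G + cut (PowerSeries.coeff n T)) := by
    intro T
    have hc : PowerSeries.coeff 0 T = PowerSeries.constantCoeff T := by simp
    rw [IsPreimage, and_comm, hc, PowerSeries.ext_iff]
    refine and_congr_right fun _ => forall_congr' fun n => ?_
    have h0 : ((n : ℚ) + 1) ≠ 0 := by positivity
    have h1 : (PowerSeries.coeff n) (PowerSeries.derivative Coeffs T) =
        ((n : ℚ) + 1) • PowerSeries.coeff (n + 1) T := by
      rw [PowerSeries.coeff_derivative, MvPolynomial.smul_eq_C_mul]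
      simp [mul_comm]
    rw [map_sub, h1, cutY, PowerSeries.coeff_mk, sub_eq_iff_eq_add, one_div,
      eq_inv_smul_iff₀ h0]
  let t : ℕ → Coeffs := fun n => Nat.rec 0
    (fun n p => (1 / ((n : ℚ) + 1)) • (PowerSeries.coeff n G + cut p)) n
  refine ⟨PowerSeries.mk t, (key _).2 ⟨by rw [PowerSeries.coeff_mk]; rfl, fun n => by
    simp only [PowerSeries.coeff_mk]; rfl⟩, fun T hT => ?_⟩
  obtain ⟨h0, hs⟩ := (key T).1 hT
  ext1 n
  rw [PowerSeries.coeff_mk]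
  induction n with
  | zero => exact h0
  | succ n ih => rw [hs, ih]

/-- `τ_{R,k}`: the unique solution of `(∂/∂y - C') τ = g_{•R} φ_k(y)` with `τ = 0` at `y = 0`. -/
noncomputable def tau (R : List Bool) (k : ℕ) : SeriesY :=
  (existsUnique_isPreimage (PowerSeries.C (gVar (bl :: R)) * phi k)).choose

/-! ### Embeddings into the series in `x` and `y` -/

/-- `f_(S)` as a series in `x` and `y`. -/
noncomputable def fXY (S : List Bool) : SeriesXY := PowerSeries.C (PowerSeries.C (fVar S))

/-- `τ_{R,k}` as a series in `x` and `y`. -/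
noncomputable def tauXY (R : List Bool) (k : ℕ) : SeriesXY := PowerSeries.C (tau R k)

/-- The series `x`. -/
noncomputable def xXY : SeriesXY := PowerSeries.X

/-- `exp(x f_(∘))`. -/
noncomputable def expXF : SeriesXY :=
  PowerSeries.rescale (PowerSeries.C (fVar ([wh] : List Bool))) (PowerSeries.exp SeriesY)

/-- `∑_{n ≥ N} c_n x^n / n! f_(∘)^{n-N}`. -/
noncomputable def sumFrom (N : ℕ) (c : ℕ → ℕ) : SeriesXY :=
  PowerSeries.mk fun n =>
    if N ≤ n then
      ((c n : ℚ) / (n.factorial : ℚ)) • (PowerSeries.C (fVar ([wh] : List Bool)) : SeriesY) ^ (n - N)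
    else 0

/-- `ψ_{(3,1^{n-3})}`, for `n ≥ 3`. -/
noncomputable def psi3 (n : ℕ) : ℕ := psi n (3 ::ₘ Multiset.replicate (n - 3) 1)

/-- `ψ_{(2²,1^{n-4})}`, for `n ≥ 4`. -/
noncomputable def psi22 (n : ℕ) : ℕ := psi n (2 ::ₘ 2 ::ₘ Multiset.replicate (n - 4) 1)

end DipoleSeries

open DipoleSeries

/-! Write a dipole as a pair of cyclic orders. With `σ` the order at the root vertex and `ψ` the
inverse of the order at the other vertex, the faces are the cycles of `σ⁻¹ * ψ`, and twice the genus
is `defect`, the number of edges minus the number of cycles. The condition γ = δ = 0 says that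
nothing separates the secondary edge from the root edge in Region 4, that is, `ψ r = s`. Fixing `σ`
and `r` kills all relabellings, so the isomorphism classes with given α, β become the permutations
`ψ` with these constraints (`sum_birootedDipole`).

When β > 0, look at the edge that follows the root edge counterclockwise at the root vertex. It is a
b-edge, and deleting it leaves a dipole of the same kind with β smaller by one. Conversely, such an
edge can be inserted at every corner of the other vertex except the one between the secondary and
root edges. The face permutation is then multiplied by a transposition on each side. If the second
end lies in the root face, that face is cut in two and the genus is unchanged; this is the operator
C'. If it lies in another face, the two faces are joined and the genus rises by one; this is a
second-order operator J = ∑ g_{R•S'} ∂²/∂g_R∂f_(S), with S' running over the rotations of S. This is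
`sum_insertEdge`. With the factorial weights it reads (∂/∂y − C') B^{(k+1)} = J B^{(k)} and (∂/∂y −
C') B^{(0)} = 0, where B^{(k)} is the part of genus k.

When β = 0, the root and secondary edges bound a digon, which is the root face. Removing the root
edge leaves an arbitrary rooted dipole with all corners white, so B at y = 0 equals the series A
(`birootedSum_insertBefore`).

A series is determined by its image under ∂/∂y − C' and its value at y = 0 (`eq_of_heat_eq`), so the
system is integrated genus by genus. Genus 0 gives A^{(0)}, known because the identity is the only
permutation of defect 0. Genus 1 gives x exp(x f_∘) τ_{•∘,0} + A^{(1)}, where τ_{•∘,0} has a closed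
form in φ_1 and φ_2, and where A^{(1)} involves only ψ_{(3,1^{n-3})} and ψ_{(2²,1^{n-4})}. Applying
J once more gives a sum of terms g_{•R} φ_k times series in x and the f's, which C' and ∂/∂y treat
as constants. Each such term is integrated by τ_{R,k}, and A^{(2)} is the initial value. -/

namespace DipoleSeries

open Equiv

/-! ### Presentations of a permutation by lists -/

section Presentations

variable {n : ℕ}

/-- The cycle of `φ` through `x`, as a list starting at `x`. -/
noncomputable def orbitList (φ : Perm (Fin n)) (x : Fin n) : List (Fin n) :=
  (List.range (Function.minimalPeriod φ x)).map fun i => (φ ^ i) x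

theorem word_eq_map_orbitList (φ : Perm (Fin n)) (m : Fin n → Bool) (x : Fin n) :
    word φ m x = (orbitList φ x).map m := by
  simp [word, orbitList]

theorem orbitList_ne_nil (φ : Perm (Fin n)) (x : Fin n) : orbitList φ x ≠ [] := by
  have := minimalPeriod_pos φ x
  simp [orbitList]
  omega

theorem orbitList_map (φ : Perm (Fin n)) (x : Fin n) :
    (orbitList φ x).map φ = (orbitList φ x).rotate 1 := by
  apply List.ext_getElem
  · simp [orbitList]
  · intro i h1 h2
    simp only [List.getElem_map, orbitList, List.getElem_range, List.getElem_rotate,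
      List.length_map, List.length_range]
    rw [← Perm.mul_apply, ← pow_succ', ← Perm.iterate_eq_pow, ← Perm.iterate_eq_pow,
      Function.iterate_mod_minimalPeriod_eq]

theorem mem_orbitList {φ : Perm (Fin n)} {x y : Fin n} :
    y ∈ orbitList φ x ↔ φ.SameCycle x y := by
  simp only [orbitList, List.mem_map, List.mem_range]
  constructor
  · rintro ⟨i, -, rfl⟩
    exact (Perm.sameCycle_pow_right (n := i)).2 (Perm.SameCycle.refl φ x)
  · intro h
    obtain ⟨k, rfl⟩ := Perm.SameCycle.exists_nat_pow_eq h
    refine ⟨k % Function.minimalPeriod φ x, Nat.mod_lt _ (minimalPeriod_pos φ x), ?_⟩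
    rw [← Perm.iterate_eq_pow, ← Perm.iterate_eq_pow, Function.iterate_mod_minimalPeriod_eq]

theorem nodup_orbitList (φ : Perm (Fin n)) (x : Fin n) : (orbitList φ x).Nodup := by
  have := Function.nodup_periodicOrbit (f := φ) (x := x)
  rw [Function.periodicOrbit, Cycle.nodup_coe_iff] at this
  simpa [orbitList, Perm.iterate_eq_pow] using this

/-- The rotation relation says that `φ` advances one place along the list, cyclically, so the powers
of `φ` at `x` enumerate its entries. Distinctness makes the period exactly the length. -/
theorem orbitList_eq_of_map {φ : Perm (Fin n)} {x : Fin n} {t : List (Fin n)}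
    (hn : (x :: t).Nodup) (hm : (x :: t).map φ = (x :: t).rotate 1) :
    orbitList φ x = x :: t := by
  have hstep : ∀ i (h : i < (x :: t).length),
      φ (x :: t)[i] = (x :: t)[(i + 1) % (x :: t).length]'(Nat.mod_lt _ (by simp)) := by
    intro i h
    have := congrArg (fun l => l[i]?) hm
    simp only [List.getElem?_map] at this
    rw [List.getElem?_eq_getElem h, List.getElem?_eq_getElem (by simpa using h),
      List.getElem_rotate] at this
    simpa using this
  have hpow : ∀ k, (φ ^ k) x = (x :: t)[k % (x :: t).length]'(Nat.mod_lt _ (by simp)) := by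
    intro k
    induction k with
    | zero => simp
    | succ k ih =>
      rw [pow_succ', Perm.mul_apply, ih, hstep]
      congr 1
      simp
  have hper : Function.minimalPeriod φ x = (x :: t).length := by
    apply Nat.dvd_antisymm
    · apply Function.IsPeriodicPt.minimalPeriod_dvd
      change φ^[(x :: t).length] x = x
      rw [Perm.iterate_eq_pow, hpow]
      simp
    · have h := Function.iterate_minimalPeriod (f := φ) (x := x)
      rw [Perm.iterate_eq_pow, hpow] at h
      have h0 : (x :: t)[0] = x := rfl
      rw [← h0] at h
      have := (List.Nodup.getElem_inj_iff hn).1 h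
      exact Nat.dvd_of_mod_eq_zero this
  apply List.ext_getElem
  · simp only [orbitList, List.length_map, List.length_range, hper]
  · intro i h1 h2
    simp only [orbitList, List.getElem_map, List.getElem_range]
    rw [hpow]
    congr 1
    exact Nat.mod_eq_of_lt h2

/-- `L` lists the cycles of `φ`, each from some starting point. -/
structure Presents (φ : Perm (Fin n)) (L : Multiset (List (Fin n))) : Prop where
  sum_eq : (L.map fun l : List (Fin n) => (l : Multiset (Fin n))).sum = Finset.univ.val
  ne_nil : ∀ l ∈ L, l ≠ []
  map_eq : ∀ l ∈ L, l.map φ = l.rotate 1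

theorem count_sum_map {ι α : Type*} [DecidableEq α] (s : Multiset ι) (f : ι → Multiset α) (x : α) :
    (s.map f).sum.count x = (s.map fun i => (f i).count x).sum := by
  induction s using Multiset.induction_on with
  | empty => simp
  | cons a s ih => simp [Multiset.count_add, ih]

/-- One representative is chosen per cycle. The cycle of `r` must be listed from `r` itself, since
the root face carries a linear word read from the root corner and the other faces carry only cyclic
words. -/
theorem exists_presents (φ : Perm (Fin n)) (r : Fin n) :
    ∃ t L, Presents φ ((r :: t) ::ₘ L) := by
  classical
  let rep : Cycles φ → Fin n := fun c =>
    if c = (Quotient.mk _ r : Cycles φ) then r else c.out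
  have hrep : ∀ c, (Quotient.mk _ (rep c) : Cycles φ) = c := by
    intro c
    by_cases h : c = (Quotient.mk _ r : Cycles φ)
    · simp [rep, h]
    · simp [rep, h]
  have hmem : ∀ c x, x ∈ orbitList φ (rep c) ↔ c = (Quotient.mk _ x : Cycles φ) := by
    intro c x
    rw [mem_orbitList]
    conv_rhs => rw [← hrep c]
    exact (Quotient.eq (r := Perm.SameCycle.setoid φ)).symm
  have hr : rep (Quotient.mk _ r) = r := by simp [rep]
  have hP : Presents φ ((Finset.univ : Finset (Cycles φ)).val.map fun c => orbitList φ (rep c)) := by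
    refine ⟨?_, ?_, ?_⟩
    · rw [Multiset.map_map]
      ext x
      rw [count_sum_map, Multiset.count_eq_one_of_mem Finset.univ.nodup (Finset.mem_univ x)]
      change ∑ c : Cycles φ, _ = 1
      rw [Finset.sum_eq_single (Quotient.mk _ x : Cycles φ)]
      · simp only [Function.comp_apply, Multiset.coe_count]
        exact List.count_eq_one_of_mem (nodup_orbitList _ _) ((hmem _ _).2 rfl)
      · intro c _ hc
        simp only [Function.comp_apply, Multiset.coe_count]
        exact List.count_eq_zero.2 fun h => hc ((hmem _ _).1 h)
      · simp
    · intro l hl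
      obtain ⟨c, -, rfl⟩ := Multiset.mem_map.1 hl
      exact orbitList_ne_nil _ _
    · intro l hl
      obtain ⟨c, -, rfl⟩ := Multiset.mem_map.1 hl
      exact orbitList_map _ _
  have h1 : (Finset.univ : Finset (Cycles φ)).val = (Quotient.mk _ r : Cycles φ) ::ₘ
      (Finset.univ : Finset (Cycles φ)).val.erase (Quotient.mk _ r) :=
    (Multiset.cons_erase (Finset.mem_univ_val _)).symm
  rw [h1, Multiset.map_cons, hr] at hP
  have h2 : ∃ t, orbitList φ r = r :: t := by
    have h3 : orbitList φ r ≠ [] := orbitList_ne_nil φ r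
    have hp := minimalPeriod_pos φ r
    obtain ⟨k, hk⟩ := Nat.exists_eq_succ_of_ne_zero hp.ne'
    rw [orbitList, hk, List.range_succ_eq_map]
    exact ⟨_, rfl⟩
  obtain ⟨t, ht⟩ := h2
  rw [ht] at hP
  exact ⟨t, _, hP⟩

namespace Presents

variable {φ : Perm (Fin n)} {L : Multiset (List (Fin n))}

theorem nodup (h : Presents φ L) {l : List (Fin n)} (hl : l ∈ L) : l.Nodup := by
  have h1 : (l : Multiset (Fin n)) ≤ Finset.univ.val := by
    rw [← h.sum_eq]
    exact Multiset.single_le_sum (fun _ _ => Multiset.zero_le _) _ (Multiset.mem_map_of_mem _ hl)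
  exact Multiset.coe_nodup.1 (Multiset.nodup_of_le h1 Finset.univ.nodup)

theorem orbitList_eq (h : Presents φ L) {x : Fin n} {t : List (Fin n)} (hl : x :: t ∈ L) :
    orbitList φ x = x :: t :=
  orbitList_eq_of_map (h.nodup hl) (h.map_eq _ hl)

/-- The cycle of `φ` that contains the first entry of `l`. -/
noncomputable def cycleOfList (φ : Perm (Fin n)) (r : Fin n) (l : List (Fin n)) : Cycles φ :=
  Quotient.mk _ (l.headD r)

/-- Every point lies in exactly one list, exactly once, so every cycle is hit exactly once. This is
what turns face counts and face words into statements about `L`. -/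
theorem map_cycleOfList (h : Presents φ L) (r : Fin n) :
    L.map (cycleOfList φ r) = (Finset.univ : Finset (Cycles φ)).val := by
  classical
  ext c
  rw [Multiset.count_eq_one_of_mem Finset.univ.nodup (Finset.mem_univ c)]
  induction c using Quotient.inductionOn with
  | h x =>
    have h1 : (Finset.univ : Finset (Fin n)).val.count x = 1 :=
      Multiset.count_eq_one_of_mem Finset.univ.nodup (Finset.mem_univ x)
    rw [← h.sum_eq, count_sum_map] at h1
    rw [← h1, ← Multiset.sum_map_singleton (L.map (cycleOfList φ r)), Multiset.map_map,
      count_sum_map]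
    congr 1
    refine Multiset.map_congr rfl fun l hl => ?_
    obtain ⟨y, t, rfl⟩ := List.exists_cons_of_ne_nil (h.ne_nil l hl)
    simp only [Function.comp_apply, Multiset.count_singleton, Multiset.coe_count]
    have hiff : (⟦x⟧ : Cycles φ) = cycleOfList φ r (y :: t) ↔ x ∈ y :: t := by
      rw [← h.orbitList_eq hl, mem_orbitList, eq_comm, h.orbitList_eq hl]
      exact Quotient.eq (r := Perm.SameCycle.setoid φ)
    by_cases hx : x ∈ y :: t
    · rw [if_pos (hiff.2 hx), List.count_eq_one_of_mem (h.nodup hl) hx]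
    · rw [if_neg (mt hiff.1 hx), List.count_eq_zero.2 hx]

theorem card_cycles (h : Presents φ L) : Fintype.card (Cycles φ) = L.card := by
  have : (Finset.univ : Finset (Cycles φ)).val.card = L.card := by
    cases n with
    | zero =>
      have hL : L = 0 := by
        refine Multiset.eq_zero_of_forall_notMem fun l hl => ?_
        obtain ⟨y, t, rfl⟩ := List.exists_cons_of_ne_nil (h.ne_nil l hl)
        exact y.elim0
      subst hL
      rw [Multiset.card_zero, Multiset.card_eq_zero]
      refine Multiset.eq_zero_of_forall_notMem fun c _ => ?_
      induction c using Quotient.inductionOn with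
      | h x => exact x.elim0
    | succ n => rw [← h.map_cycleOfList 0, Multiset.card_map]
  exact this

theorem sum_length (h : Presents φ L) : (L.map List.length).sum = n := by
  have := congrArg Multiset.card h.sum_eq
  rw [← Multiset.cardHom_apply, map_multiset_sum, Multiset.map_map] at this
  have h' : (L.map List.length).sum = (Finset.univ : Finset (Fin n)).val.card := this
  simpa using h'

theorem card_le (h : Presents φ L) : L.card ≤ n := by
  conv_rhs => rw [← h.sum_length]
  have : (L.map fun _ => 1).sum ≤ (L.map List.length).sum :=
    Multiset.sum_map_le_sum_map _ _ fun l hl => List.length_pos_iff.2 (h.ne_nil l hl)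
  simpa using this

theorem cyclicWord_cycleOfList (h : Presents φ L) (m : Fin n → Bool) (r : Fin n)
    {l : List (Fin n)} (hl : l ∈ L) :
    cyclicWord φ m (cycleOfList φ r l) = (l.map m : List Bool) := by
  obtain ⟨y, t, rfl⟩ := List.exists_cons_of_ne_nil (h.ne_nil l hl)
  rw [← h.orbitList_eq hl, ← word_eq_map_orbitList, h.orbitList_eq hl]
  rfl

theorem word_eq {r : Fin n} {t : List (Fin n)} (h : Presents φ ((r :: t) ::ₘ L))
    (m : Fin n → Bool) : word φ m r = (r :: t).map m := by
  rw [word_eq_map_orbitList, h.orbitList_eq (Multiset.mem_cons_self _ _)]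

theorem erase_map_cyclicWord [DecidableEq (Cycles φ)] {r : Fin n} {t : List (Fin n)}
    (h : Presents φ ((r :: t) ::ₘ L)) (m : Fin n → Bool) :
    ((Finset.univ : Finset (Cycles φ)).erase (Quotient.mk _ r)).val.map (cyclicWord φ m) =
      L.map fun l => ((l.map m : List Bool) : Cycle Bool) := by
  rw [Finset.erase_val, ← h.map_cycleOfList r, Multiset.map_cons]
  have : cycleOfList φ r (r :: t) = Quotient.mk _ r := rfl
  rw [this, Multiset.erase_cons_head, Multiset.map_map]
  exact Multiset.map_congr rfl fun l hl =>
    h.cyclicWord_cycleOfList m r (Multiset.mem_cons_of_mem hl)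

theorem map_cyclicWord (h : Presents φ L) (m : Fin n → Bool) :
    (Finset.univ : Finset (Cycles φ)).val.map (cyclicWord φ m) =
      L.map fun l => ((l.map m : List Bool) : Cycle Bool) := by
  cases n with
  | zero =>
    have hL : L = 0 := by
      refine Multiset.eq_zero_of_forall_notMem fun l hl => ?_
      obtain ⟨y, t, rfl⟩ := List.exists_cons_of_ne_nil (h.ne_nil l hl)
      exact y.elim0
    have := h.card_cycles
    subst hL
    rw [Multiset.card_zero] at this
    rw [Finset.card_eq_zero.1 this]
    rfl
  | succ n =>
    rw [← h.map_cycleOfList 0, Multiset.map_map]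
    exact Multiset.map_congr rfl fun l hl => h.cyclicWord_cycleOfList m 0 hl

end Presents

end Presentations

/-! ### Inserting an edge -/

section Insertion

variable {n : ℕ}

namespace Presents

variable {φ : Perm (Fin n)} {L : Multiset (List (Fin n))}

theorem notMem_of_mem {l l' : List (Fin n)} (h : Presents φ (l ::ₘ L)) (hl' : l' ∈ L)
    {x : Fin n} (hx : x ∈ l) : x ∉ l' := by
  intro hx'
  have hs := h.sum_eq
  rw [Multiset.map_cons, Multiset.sum_cons] at hs
  have hn : ((l : Multiset (Fin n)) + (L.map fun l : List (Fin n) => (l : Multiset (Fin n))).sum).Nodup :=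
    hs ▸ Finset.univ.nodup
  refine Multiset.disjoint_left.1 (Multiset.nodup_add.1 hn).2.2 (Multiset.mem_coe.2 hx) ?_
  exact Multiset.mem_join.2 ⟨l', Multiset.mem_map_of_mem _ hl', hx'⟩

theorem map_swap_of_notMem {a b : Fin n} {l : List (Fin n)} (ha : a ∉ l) (hb : b ∉ l) :
    l.map (swap a b) = l := by
  conv_rhs => rw [← List.map_id l]
  exact List.map_congr_left fun x hx =>
    swap_apply_of_ne_of_ne (fun h => ha (h ▸ hx)) (fun h => hb (h ▸ hx))

theorem map_conj_swap_of_notMem {r e p : Fin n} {l : List (Fin n)} (hr : r ∉ l) (he : e ∉ l)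
    (hp : p ∉ l) (hφ : l.map φ = l.rotate 1) :
    l.map (swap r e * φ * swap p e) = l.rotate 1 := by
  have h1 : l.map (swap r e * φ * swap p e) = ((l.map (swap p e)).map φ).map (swap r e) := by
    simp [Function.comp_def]
  rw [h1, map_swap_of_notMem hp he, hφ, map_swap_of_notMem] <;> simpa

theorem fixed_of_singleton {e : Fin n} (h : Presents φ L) (he : [e] ∈ L) : φ e = e := by
  simpa using h.map_eq _ he

/-- Inserting an edge `e` into two corners of the root face. -/
theorem cut {r e p : Fin n} {u w v : List (Fin n)}
    (h : Presents φ ((r :: u ++ v) ::ₘ [e] ::ₘ L)) (hw : r :: u = w ++ [p]) :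
    Presents (swap r e * φ * swap p e) ((r :: u) ::ₘ (e :: v) ::ₘ L) := by
  have he : φ e = e := h.fixed_of_singleton (by simp)
  have hnd := h.nodup (Multiset.mem_cons_self _ _)
  have hpm : p ∈ r :: u ++ v := by rw [hw]; simp
  have her : e ∉ r :: u ++ v := fun hx => h.notMem_of_mem (l' := [e]) (by simp) hx (by simp)
  have hm := h.map_eq _ (Multiset.mem_cons_self _ _)
  have hm' : w.map φ ++ (φ p :: v.map φ) = u ++ (v ++ [r]) := by
    rw [hw] at hm
    have h2 : (w ++ [p] ++ v).rotate 1 = u ++ v ++ [r] := by rw [← hw]; simp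
    rw [h2] at hm
    simpa using hm
  have hlen : (w.map φ).length = u.length := by
    have := congrArg List.length hw
    simp at this
    simpa using this.symm
  -- The cyclic relation splits where the root face is cut: `φ` maps `w` onto `u`, and `p :: v` onto
  -- `v ++ [r]`.
  obtain ⟨h1, h2⟩ := List.append_inj hm' hlen
  refine ⟨?_, ?_, ?_⟩
  · rw [← h.sum_eq]
    simp only [Multiset.map_cons, Multiset.sum_cons, ← add_assoc]
    congr 1
    simp only [Multiset.coe_add, Multiset.coe_eq_coe, List.append_assoc]
    refine List.Perm.append_left _ ?_
    exact (List.perm_append_singleton e v).symm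
  · intro l hl
    simp only [Multiset.mem_cons] at hl
    rcases hl with rfl | rfl | hl
    · simp
    · simp
    · exact h.ne_nil l (by simp [hl])
  · intro l hl
    simp only [Multiset.mem_cons] at hl
    have hru : r ∉ u := by
      intro hx
      simp only [List.cons_append, List.nodup_cons, List.mem_append] at hnd
      exact hnd.1 (Or.inl hx)
    have hrv : r ∉ v := by
      intro hx
      simp only [List.cons_append, List.nodup_cons, List.mem_append] at hnd
      exact hnd.1 (Or.inr hx)
    simp only [List.cons_append, List.mem_cons, List.mem_append, not_or] at her
    rcases hl with rfl | rfl | hl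
    · rw [hw]
      have hwp : p ∉ w := by
        rw [hw, List.append_assoc, List.nodup_append] at hnd
        intro hx
        exact hnd.2.2 p hx p (by simp) rfl
      have hwe : e ∉ w := by
        intro hx
        have : e ∈ r :: u := by rw [hw]; simp [hx]
        simp [her] at this
      have h3 : w.map (swap r e * φ * swap p e) = u := by
        have : w.map (swap r e * φ * swap p e) = ((w.map (swap p e)).map φ).map (swap r e) := by
          simp [Function.comp_def]
        rw [this, map_swap_of_notMem hwp hwe, h1, map_swap_of_notMem hru her.2.1]
      rw [List.map_append, h3, ← hw]
      simp [he]
    · have hpv : p ∉ v := by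
        rw [hw, List.nodup_append] at hnd
        intro hx
        exact hnd.2.2 p (by simp) p hx rfl
      have h4 : (e :: v).map (swap r e * φ * swap p e) = (φ p :: v.map φ).map (swap r e) := by
        simp only [List.map_cons, Perm.mul_apply, swap_apply_right, List.map_map]
        congr 1
        refine List.map_congr_left fun x hx => ?_
        rw [Perm.mul_apply, Perm.mul_apply, swap_apply_of_ne_of_ne (ne_of_mem_of_not_mem hx hpv)
          (ne_of_mem_of_not_mem hx her.2.2)]
        rfl
      rw [h4, h2, List.map_append, map_swap_of_notMem hrv her.2.2]
      simp
    · refine map_conj_swap_of_notMem ?_ ?_ ?_ (h.map_eq l (by simp [hl]))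
      · exact h.notMem_of_mem (by simp [hl]) (by simp)
      · have h' := h
        rw [Multiset.cons_swap] at h'
        exact h'.notMem_of_mem (by simp [hl]) (by simp)
      · exact h.notMem_of_mem (by simp [hl]) hpm

/-- Inserting an edge `e` into a corner of the root face and a corner of another face. -/
theorem join {r e p : Fin n} {t v : List (Fin n)}
    (h : Presents φ ((r :: t) ::ₘ [e] ::ₘ (v ++ [p]) ::ₘ L)) :
    Presents (swap r e * φ * swap p e) ((r :: (t ++ e :: (v ++ [p]))) ::ₘ L) := by
  have he : φ e = e := h.fixed_of_singleton (by simp)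
  have h' := h
  rw [Multiset.cons_swap] at h'
  have h'' := h
  rw [Multiset.cons_swap [e], Multiset.cons_swap] at h''
  have her : e ∉ r :: t := fun hx => h.notMem_of_mem (l' := [e]) (by simp) hx (by simp)
  have hep : e ∉ v ++ [p] := h'.notMem_of_mem (by simp) (by simp)
  have hrp : r ∉ v ++ [p] := h.notMem_of_mem (by simp) (by simp)
  have hpr : p ∉ r :: t := h''.notMem_of_mem (by simp) (by simp)
  have hnd := h.nodup (Multiset.mem_cons_self _ _)
  have hnd' := h''.nodup (Multiset.mem_cons_self _ _)
  have hpv : p ∉ v := by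
    rw [List.nodup_append] at hnd'
    exact fun hx => hnd'.2.2 p hx p (by simp) rfl
  have hm : (r :: t).map φ = t ++ [r] := by simpa using h.map_eq _ (Multiset.mem_cons_self _ _)
  -- The same cyclic relation read from `p`: the walk on the second face resumes at `φ p`, which
  -- becomes the successor of `e` after the insertion.
  have hm2 : φ p :: v.map φ = v ++ [p] := by
    have h1 := h''.map_eq _ (Multiset.mem_cons_self _ _)
    have h2 : (v ++ [p]).rotate v.length = p :: v := by simp
    have h3 := congrArg (List.rotate · v.length) h1
    simp only [List.rotate_rotate] at h3
    rw [← List.map_rotate, h2, add_comm, ← List.rotate_rotate, h2] at h3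
    simpa using h3
  have key : ∀ l : List (Fin n), e ∉ l → p ∉ l →
      l.map (swap r e * φ * swap p e) = (l.map φ).map (swap r e) := by
    intro l he' hp'
    have : l.map (swap r e * φ * swap p e) = ((l.map (swap p e)).map φ).map (swap r e) := by
      simp [Function.comp_def]
    rw [this, map_swap_of_notMem hp' he']
  refine ⟨?_, ?_, ?_⟩
  · rw [← h.sum_eq]
    simp only [Multiset.map_cons, Multiset.sum_cons, ← add_assoc]
    congr 1
    rw [Multiset.coe_add, Multiset.coe_add]
    simp
  · intro l hl
    simp only [Multiset.mem_cons] at hl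
    rcases hl with rfl | hl
    · simp
    · exact h.ne_nil l (by simp [hl])
  · intro l hl
    simp only [Multiset.mem_cons] at hl
    rcases hl with rfl | hl
    · have hrt : r ∉ t := (List.nodup_cons.1 hnd).1
      have het : e ∉ t := fun hx => her (by simp [hx])
      have h1 : (r :: t).map (swap r e * φ * swap p e) = t ++ [e] := by
        rw [key _ her hpr, hm, List.map_append, map_swap_of_notMem hrt het]
        simp
      have h2 : (swap r e * φ * swap p e) e :: v.map (swap r e * φ * swap p e) = v ++ [p] := by
        rw [key v (fun hx => hep (by simp [hx])) hpv]
        have : (swap r e * φ * swap p e) e = swap r e (φ p) := by simp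
        rw [this, ← List.map_cons, hm2, map_swap_of_notMem hrp hep]
      -- The merged walk closes up here: it runs from `r` through `t` to `e`, then around the second
      -- face to `p`, and back to `r`.
      have h3 : (swap r e * φ * swap p e) p = r := by simp [he]
      rw [← List.cons_append, List.map_append, h1, List.map_cons, List.map_append,
        ← List.cons_append, h2]
      simp [he]
    · refine map_conj_swap_of_notMem ?_ ?_ ?_ (h.map_eq l (by simp [hl]))
      · exact h.notMem_of_mem (by simp [hl]) (by simp)
      · exact h'.notMem_of_mem (by simp [hl]) (by simp)
      · exact h''.notMem_of_mem (by simp [hl]) (by simp)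

theorem rotate {l : List (Fin n)} (h : Presents φ (l ::ₘ L)) (k : ℕ) :
    Presents φ (l.rotate k ::ₘ L) := by
  refine ⟨?_, ?_, ?_⟩
  · rw [← h.sum_eq]
    simp only [Multiset.map_cons, Multiset.sum_cons]
    congr 1
    exact Multiset.coe_eq_coe.2 (List.rotate_perm l k)
  · intro l' hl
    rcases Multiset.mem_cons.1 hl with rfl | hl
    · rw [Ne, List.rotate_eq_nil_iff]
      exact h.ne_nil l (by simp)
    · exact h.ne_nil l' (by simp [hl])
  · intro l' hl
    rcases Multiset.mem_cons.1 hl with rfl | hl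
    · rw [List.map_rotate, h.map_eq l (by simp), List.rotate_rotate, List.rotate_rotate, add_comm]
    · exact h.map_eq l' (by simp [hl])

end Presents

/-- `φ` as a permutation of `Fin (n + 1)` that fixes the last element. -/
def up (φ : Perm (Fin n)) : Perm (Fin (n + 1)) :=
  finSuccEquivLast.symm.permCongr (optionCongr φ)

@[simp] theorem up_castSucc (φ : Perm (Fin n)) (x : Fin n) : up φ x.castSucc = (φ x).castSucc := by
  simp [up]

@[simp] theorem up_last (φ : Perm (Fin n)) : up φ (Fin.last n) = Fin.last n := by
  simp [up]

theorem up_mul (φ ψ : Perm (Fin n)) : up (φ * ψ) = up φ * up ψ := by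
  ext x
  induction x using Fin.lastCases <;> simp

theorem up_inv (φ : Perm (Fin n)) : up φ⁻¹ = (up φ)⁻¹ := by
  rw [eq_inv_iff_mul_eq_one, ← up_mul]
  ext x
  induction x using Fin.lastCases <;> simp

theorem up_injective : Function.Injective (up : Perm (Fin n) → Perm (Fin (n + 1))) := by
  intro φ ψ h
  ext x
  have := congrArg (fun π => ((π x.castSucc : Fin (n + 1)) : ℕ)) h
  simpa using this

theorem exists_eq_up {ψ : Perm (Fin (n + 1))} (h : ψ (Fin.last n) = Fin.last n) :
    ∃ φ, ψ = up φ := by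
  have hne : ∀ x : Fin n, ψ x.castSucc ≠ Fin.last n := fun x hx =>
    Fin.castSucc_ne_last x (ψ.injective (hx.trans h.symm))
  let f : Fin n → Fin n := fun x => (ψ x.castSucc).castPred (hne x)
  have hf : Function.Injective f := fun x y hxy =>
    Fin.castSucc_injective n (ψ.injective (Fin.castPred_inj.1 hxy))
  refine ⟨Equiv.ofBijective f (Finite.injective_iff_bijective.1 hf), ?_⟩
  ext x
  induction x using Fin.lastCases with
  | last => simp [h]
  | cast x => simp [f]

theorem Presents.up {φ : Perm (Fin n)} {L : Multiset (List (Fin n))} (h : Presents φ L) :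
    Presents (up φ) ([Fin.last n] ::ₘ L.map (List.map Fin.castSucc)) := by
  refine ⟨?_, ?_, ?_⟩
  · rw [Fin.univ_castSuccEmb, Finset.cons_val, Finset.map_val, ← h.sum_eq, Multiset.map_cons,
      Multiset.sum_cons, ← Multiset.coe_mapAddMonoidHom Fin.castSuccEmb, map_multiset_sum,
      Multiset.map_map]
    rw [Multiset.map_map]
    rfl
  · intro l hl
    rcases Multiset.mem_cons.1 hl with rfl | hl
    · simp
    · obtain ⟨l, hl', rfl⟩ := Multiset.mem_map.1 hl
      simpa using h.ne_nil l hl'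
  · intro l hl
    rcases Multiset.mem_cons.1 hl with rfl | hl
    · simp
    · obtain ⟨l, hl', rfl⟩ := Multiset.mem_map.1 hl
      rw [← List.map_rotate, ← h.map_eq l hl']
      simp

end Insertion

/-! ### The join operator -/

/-- `∂/∂g_R` for all `R` at once. -/
noncomputable def gradG : Derivation ℚ Coeffs (List Bool →₀ Coeffs) :=
  MvPolynomial.mkDerivation ℚ (Sum.elim (fun R => Finsupp.single R 1) fun _ => 0)

/-- The derivation `∑_S (∑ g_{R • S'}) ∂/∂f_(S)`, where `S'` runs over the rotations of `S`. -/
noncomputable def joinWith (R : List Bool) : Derivation ℚ Coeffs Coeffs :=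
  MvPolynomial.mkDerivation ℚ (Sum.elim (fun _ => 0)
    fun S => (S.lists.map fun l => gVar (R ++ bl :: l)).sum)

/-- The operator `∑_R ∑_S (∑ g_{R • S'}) ∂²/∂g_R∂f_(S)`, where `S'` runs over the rotations
of `S`. -/
noncomputable def join : Coeffs →ₗ[ℚ] Coeffs :=
  (Finsupp.lsum ℚ fun R => (joinWith R).toLinearMap) ∘ₗ gradG.toLinearMap

/-- The polynomials in the `f_(S)`. -/
noncomputable def fAlgebra : Subalgebra ℚ Coeffs := Algebra.adjoin ℚ (Set.range fVar)

theorem fVar_mem (S : Cycle Bool) : fVar S ∈ fAlgebra := Algebra.subset_adjoin ⟨S, rfl⟩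

theorem fMonomial_mem (L : Multiset (Cycle Bool)) : fMonomial L ∈ fAlgebra := by
  refine Subalgebra.multiset_prod_mem _ fun x hx => ?_
  obtain ⟨S, -, rfl⟩ := Multiset.mem_map.1 hx
  exact fVar_mem S

theorem derivation_eq_zero_of_mem {M : Type*} [AddCommMonoid M] [Module Coeffs M] [Module ℚ M]
    {D : Derivation ℚ Coeffs M} (hD : ∀ S, D (fVar S) = 0) {p : Coeffs} (hp : p ∈ fAlgebra) :
    D p = 0 := by
  have : Set.EqOn D (0 : Derivation ℚ Coeffs M) (Set.range fVar) := by
    rintro _ ⟨S, rfl⟩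
    exact hD S
  exact Derivation.eqOn_adjoin this hp

theorem cut_gVar (R : List Bool) : cut (gVar R) = ∑ i ∈ Finset.Icc 2 R.length,
    gVar (R.take i) * fVar ((R.take 1 ++ R.drop i : List Bool) : Cycle Bool) := by
  simp [cut, gVar, MvPolynomial.mkDerivation_X]

theorem cut_fVar (S : Cycle Bool) : cut (fVar S) = 0 := by
  simp [cut, fVar, MvPolynomial.mkDerivation_X]

theorem cut_eq_zero_of_mem {p : Coeffs} (hp : p ∈ fAlgebra) : cut p = 0 :=
  derivation_eq_zero_of_mem cut_fVar hp

theorem cut_mul_of_mem {p : Coeffs} (hp : p ∈ fAlgebra) (q : Coeffs) :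
    cut (p * q) = p * cut q := by
  rw [Derivation.leibniz, cut_eq_zero_of_mem hp]
  simp

theorem joinWith_fVar (R : List Bool) (S : Cycle Bool) :
    joinWith R (fVar S) = (S.lists.map fun l => gVar (R ++ bl :: l)).sum := by
  simp [joinWith, fVar, MvPolynomial.mkDerivation_X]

theorem gradG_gVar (R : List Bool) : gradG (gVar R) = Finsupp.single R 1 := by
  simp [gradG, gVar, MvPolynomial.mkDerivation_X]

theorem gradG_fVar (S : Cycle Bool) : gradG (fVar S) = 0 := by
  simp [gradG, fVar, MvPolynomial.mkDerivation_X]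

/-- A dipole weight is linear in the g's, with only one root word, so differentiating by the g's
selects `R`. On such terms the second-order operator acts as a derivation in the f's. -/
theorem join_gVar_mul (R : List Bool) {p : Coeffs} (hp : p ∈ fAlgebra) :
    join (gVar R * p) = joinWith R p := by
  have h : gradG (gVar R * p) = Finsupp.single R p := by
    rw [Derivation.leibniz, derivation_eq_zero_of_mem gradG_fVar hp, gradG_gVar]
    simp
  simp [join, h]

theorem derivation_multiset_prod {ι : Type*} [DecidableEq ι]
    (D : Derivation ℚ Coeffs Coeffs) (L : Multiset ι) (f : ι → Coeffs) :
    D (L.map f).prod = (L.map fun l => ((L.erase l).map f).prod * D (f l)).sum := by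
  induction L using Multiset.induction_on with
  | empty => simp
  | cons a L ih =>
    rw [Multiset.map_cons, Multiset.prod_cons, Derivation.leibniz, ih, Multiset.map_cons,
      Multiset.sum_cons, Multiset.erase_cons_head, add_comm]
    simp only [smul_eq_mul]
    congr 1
    rw [← Multiset.sum_map_mul_left]
    congr 1
    refine Multiset.map_congr rfl fun l hl => ?_
    by_cases h : a = l
    · subst h
      rw [Multiset.erase_cons_head, ← mul_assoc, ← Multiset.prod_cons, ← Multiset.map_cons,
        Multiset.cons_erase hl]
    · rw [Multiset.erase_cons_tail _ h, Multiset.map_cons, Multiset.prod_cons, mul_assoc]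

theorem list_sum_map_eq {α M : Type*} [AddCommMonoid M] (l : List α) (h : α → M) (F : ℕ → M)
    (hF : ∀ i (hi : i < l.length), h l[i] = F i) :
    (l.map h).sum = ∑ i ∈ Finset.range l.length, F i := by
  rw [Finset.sum_range, ← Fin.sum_univ_getElem]
  have hl : (l.map h).length = l.length := List.length_map _
  rw [← Fintype.sum_equiv (finCongr hl) (fun i => F i)]
  · exact Finset.sum_congr rfl fun i _ => by simpa using hF i (by simpa using i.2)
  · exact fun i => rfl

/-! ### Weights of face permutations -/

section Weight

variable {n : ℕ}

open Classical in
/-- The monomial `g_R f_Λ`, where `R` is the word of `m` around the cycle of `φ` through `r` and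
`Λ` is the multiset of the cyclic words around the other cycles. -/
noncomputable def weight (φ : Perm (Fin n)) (m : Fin n → Bool) (r : Fin n) : Coeffs :=
  gVar (word φ m r) *
    fMonomial (((Finset.univ : Finset (Cycles φ)).erase (Quotient.mk _ r)).val.map
      (cyclicWord φ m))

/-- The number of points minus the number of cycles. -/
noncomputable def defect (φ : Perm (Fin n)) : ℕ := n - Fintype.card (Cycles φ)

namespace Presents

variable {φ : Perm (Fin n)} {L : Multiset (List (Fin n))} {r : Fin n} {t : List (Fin n)}

theorem weight_eq (h : Presents φ ((r :: t) ::ₘ L)) (m : Fin n → Bool) :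
    weight φ m r = gVar ((r :: t).map m) *
      (L.map fun l => fVar ((l.map m : List Bool) : Cycle Bool)).prod := by
  classical
  have h2 := h.erase_map_cyclicWord m
  rw [weight, h.word_eq m, fMonomial]
  congr 1
  have h3 : (L.map fun l => fVar ((l.map m : List Bool) : Cycle Bool)) =
      (L.map fun l => ((l.map m : List Bool) : Cycle Bool)).map fVar := by
    rw [Multiset.map_map]
    rfl
  rw [h3, ← h2]

theorem defect_eq (h : Presents φ L) : defect φ = n - L.card := by
  rw [defect, h.card_cycles]

end Presents

/-- The face permutation after inserting an edge (the last one) into the corner of `r` at the root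
vertex, and so that the walk leaving along `p` comes back along `r`. -/
def insertEdge (φ : Perm (Fin n)) (r p : Fin n) : Perm (Fin (n + 1)) :=
  swap r.castSucc (Fin.last n) * up φ * swap p.castSucc (Fin.last n)

/-- Marks for `Fin (n + 1)` from marks for `Fin n`. -/
def extendMark (b : Bool) (m : Fin n → Bool) : Fin (n + 1) → Bool :=
  Fin.lastCases b m

@[simp] theorem extendMark_castSucc (b : Bool) (m : Fin n → Bool) (x : Fin n) :
    extendMark b m x.castSucc = m x := by simp [extendMark]

@[simp] theorem extendMark_last (b : Bool) (m : Fin n → Bool) :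
    extendMark b m (Fin.last n) = b := by simp [extendMark]

theorem map_extendMark (b : Bool) (m : Fin n → Bool) (l : List (Fin n)) :
    (l.map Fin.castSucc).map (extendMark b m) = l.map m := by
  simp [Function.comp_def]

theorem map_map_extendMark (b : Bool) (m : Fin n → Bool) (L : Multiset (List (Fin n))) :
    ((L.map (List.map Fin.castSucc)).map
      fun l => fVar ((l.map (extendMark b m) : List Bool) : Cycle Bool)) =
    L.map fun l => fVar ((l.map m : List Bool) : Cycle Bool) := by
  rw [Multiset.map_map]
  refine Multiset.map_congr rfl fun l _ => ?_
  rw [Function.comp_apply, map_extendMark]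

namespace Presents

variable {φ : Perm (Fin n)} {L : Multiset (List (Fin n))} {r : Fin n} {t : List (Fin n)}

/-- The case where both ends of the new edge lie in the root face. The walk now returns to `r` after
`t[i]`; the rest of the old root face becomes a separate face through the new corner. -/
theorem insertEdge_cut (h : Presents φ ((r :: t) ::ₘ L)) (i : ℕ) (hi : i < t.length) :
    Presents (insertEdge φ r t[i])
      ((r :: t.take (i + 1)).map Fin.castSucc ::ₘ
        (Fin.last n :: (t.drop (i + 1)).map Fin.castSucc) ::ₘ L.map (List.map Fin.castSucc)) := by
  have h1 := h.up
  rw [Multiset.map_cons, Multiset.cons_swap] at h1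
  have h2 : (r :: t).map Fin.castSucc = r.castSucc :: (t.take (i + 1)).map Fin.castSucc ++
      (t.drop (i + 1)).map Fin.castSucc := by
    rw [List.cons_append, ← List.map_append, List.take_append_drop]
    simp
  rw [h2] at h1
  have := h1.cut (w := (r :: t.take i).map Fin.castSucc) (p := t[i].castSucc) (by
    simp only [List.map_cons, List.cons_append, List.take_succ_eq_append_getElem hi,
      List.map_append, List.map_nil])
  simpa [insertEdge] using this

/-- The case where the ends lie in different faces. The second face is listed so that `p` comes
last, since the new walk returns from `p` to `r`. -/
theorem insertEdge_join {v : List (Fin n)} {p : Fin n}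
    (h : Presents φ ((r :: t) ::ₘ (v ++ [p]) ::ₘ L)) :
    Presents (insertEdge φ r p)
      ((r.castSucc :: (t.map Fin.castSucc ++ Fin.last n :: (v ++ [p]).map Fin.castSucc)) ::ₘ
        L.map (List.map Fin.castSucc)) := by
  have h1 := h.up
  rw [Multiset.map_cons, Multiset.cons_swap, Multiset.map_cons] at h1
  simp only [List.map_cons, List.map_append, List.map_nil] at h1 ⊢
  exact h1.join

end Presents

/-- Rotations are counted with multiplicity, one for each corner of the face. Rotating by `i + 1`
puts corner `i` last, as the join insertion requires. -/
theorem sum_lists {M : Type*} [AddCommMonoid M] {l : List Bool} (hl : l ≠ []) (F : List Bool → M) :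
    ((l : Cycle Bool).lists.map F).sum = ∑ i ∈ Finset.range l.length, F (l.rotate (i + 1)) := by
  have h : (l : Cycle Bool) = (l.rotate 1 : List Bool) := Cycle.coe_eq_coe.2 ⟨1, rfl⟩
  have hl' : l.rotate 1 ≠ [] := by simpa using hl
  rw [h, Cycle.lists_coe, Multiset.map_coe, Multiset.sum_coe]
  rw [list_sum_map_eq _ F (fun i => F (l.rotate (i + 1))),
    List.length_cyclicPermutations_of_ne_nil _ hl', List.length_rotate]
  intro i hi
  rw [List.getElem_cyclicPermutations, List.rotate_rotate, add_comm]

-- The central computation. Insertion points `p` in the root face give the terms of C', and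
-- insertion points in other faces give the terms of `join`. One edge is added each time: cutting
-- adds a face, so the defect is preserved, while joining removes a face, so the defect grows by 2.
-- The hypothesis on `r` gives the new corner the colour R₁, which is the first letter of the cyclic
-- word that C' cuts off.
open Classical in
theorem sum_insertEdge (φ : Perm (Fin n)) (r : Fin n) (m : Fin n → Bool) (hm : m r = bl) (k : ℕ) :
    ∑ p ∈ Finset.univ.erase r, (if defect (insertEdge φ r p) = k then
        weight (insertEdge φ r p) (extendMark bl m) r.castSucc else 0) =
      (if defect φ = k then cut (weight φ m r) else 0) +
        if defect φ + 2 = k then join (weight φ m r) else 0 := by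
  obtain ⟨t, L, h⟩ := exists_presents φ r
  set H : Fin n → Coeffs := fun p => if defect (insertEdge φ r p) = k then
        weight (insertEdge φ r p) (extendMark bl m) r.castSucc else 0 with hH
  have hcard := h.card_le
  have hdef := h.defect_eq
  rw [Multiset.card_cons] at hcard hdef
  have hval : (Finset.univ.erase r : Finset (Fin n)).val =
      (t : Multiset (Fin n)) + (L.map fun l : List (Fin n) => (l : Multiset (Fin n))).sum := by
    rw [Finset.erase_val, ← h.sum_eq, Multiset.map_cons, Multiset.sum_cons, ← Multiset.cons_coe,
      Multiset.cons_add, Multiset.erase_cons_head]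
  set P : Coeffs := (L.map fun l => fVar ((l.map m : List Bool) : Cycle Bool)).prod with hP
  have hPmem : P ∈ fAlgebra := by
    refine Subalgebra.multiset_prod_mem _ fun x hx => ?_
    obtain ⟨l, -, rfl⟩ := Multiset.mem_map.1 hx
    exact fVar_mem _
  have hW := h.weight_eq m
  rw [← hP] at hW
  have hsum : ∑ p ∈ Finset.univ.erase r, H p =
      (t.map H).sum + (L.map fun l => (l.map H).sum).sum := by
    rw [Finset.sum_eq_multiset_sum, hval, Multiset.map_add, Multiset.sum_add, Multiset.map_coe,
      Multiset.sum_coe]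
    congr 1
    have : ∀ L' : Multiset (List (Fin n)),
        ((L'.map fun l : List (Fin n) => (l : Multiset (Fin n))).sum.map H).sum =
        (L'.map fun l => (l.map H).sum).sum := by
      intro L'
      induction L' using Multiset.induction_on with
      | empty => simp
      | cons a L' ih => simp [ih]
    exact this L
  rw [hsum]
  congr 1
  · rw [list_sum_map_eq t H fun i => if defect φ = k then
        gVar (((r :: t).map m).take (i + 2)) *
          fVar ((((r :: t).map m).take 1 ++ ((r :: t).map m).drop (i + 2) : List Bool) :
            Cycle Bool) * P else 0]
    · split_ifs with hk
      · rw [hW, mul_comm, cut_mul_of_mem hPmem, cut_gVar, Finset.mul_sum]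
        -- The new root face contains `r` and the first `i + 1` entries of `t`, so its word has
        -- length `i + 2`. The excluded point `p = r` would give a prefix of length 1, which is why
        -- the sum in C' starts at 2.
        refine Finset.sum_nbij' (· + 2) (· - 2) ?_ ?_ ?_ ?_ ?_
        · intro i hi
          simp at hi ⊢
          omega
        · intro i hi
          simp at hi ⊢
          omega
        · intro i hi
          simp
        · intro i hi
          simp at hi ⊢
          omega
        · intro i hi
          ring
      · simp
    · intro i hi
      have hc := h.insertEdge_cut i hi
      have hd : defect (insertEdge φ r t[i]) = defect φ := by
        rw [hc.defect_eq, hdef]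
        simp only [Multiset.card_cons, Multiset.card_map]
        omega
      rw [hH]
      simp only [hd]
      refine if_congr Iff.rfl ?_ rfl
      rw [List.map_cons] at hc
      rw [hc.weight_eq, Multiset.map_cons, Multiset.prod_cons, map_map_extendMark, ← hP,
        ← List.map_cons, map_extendMark]
      simp [hm, Function.comp_def, mul_assoc]
  · have hj : ∀ l ∈ L, ∀ i (hi : i < l.length), H l[i] = if defect φ + 2 = k then
        ((L.erase l).map fun l => fVar ((l.map m : List Bool) : Cycle Bool)).prod *
          gVar ((r :: t).map m ++ bl :: (l.map m).rotate (i + 1)) else 0 := by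
      intro l hl i hi
      -- The face is relisted so that the insertion point is its last entry.
      have hrot : l.rotate (i + 1) = (l.drop (i + 1) ++ l.take i) ++ [l[i]] := by
        rw [List.rotate_eq_drop_append_take hi, List.take_succ_eq_append_getElem hi,
          List.append_assoc]
      have h1 := h
      rw [← Multiset.cons_erase hl, Multiset.cons_swap] at h1
      have h2 := h1.rotate (i + 1)
      rw [Multiset.cons_swap, hrot] at h2
      have hc := h2.insertEdge_join
      have hcd := hc.defect_eq
      have hce : (L.erase l).card + 1 = L.card := Multiset.card_erase_add_one hl
      rw [Multiset.card_cons, Multiset.card_map] at hcd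
      have hd : defect (insertEdge φ r l[i]) = defect φ + 2 := by
        rw [hcd, hdef]
        omega
      rw [hH]
      simp only [hd]
      refine if_congr Iff.rfl ?_ rfl
      rw [hc.weight_eq, map_map_extendMark, ← hrot, mul_comm, ← List.map_rotate]
      simp [Function.comp_def]
    by_cases hk : defect φ + 2 = k
    · rw [if_pos hk, hW, join_gVar_mul _ hPmem, hP, derivation_multiset_prod]
      congr 1
      refine Multiset.map_congr rfl fun l hl => ?_
      have hl0 : l ≠ [] := h.ne_nil l (by simp [hl])
      rw [joinWith_fVar, sum_lists (by simpa using hl0), Finset.mul_sum, List.length_map]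
      exact list_sum_map_eq _ _ _ fun i hi => by rw [hj l hl i hi, if_pos hk]
    · rw [if_neg hk]
      refine Multiset.sum_eq_zero fun x hx => ?_
      obtain ⟨l, hl, rfl⟩ := Multiset.mem_map.1 hx
      rw [list_sum_map_eq l H fun _ => 0]
      · simp
      · exact fun i hi => by rw [hj l hl i hi, if_neg hk]

end Weight

/-! ### Cyclic orders -/

section FullCycles

variable {n : ℕ}

theorem isCycleOn_univ_iff {σ : Perm (Fin n)} :
    σ.IsCycleOn Set.univ ↔ ∀ x y, σ.SameCycle x y :=
  ⟨fun h x y => h.2 (Set.mem_univ x) (Set.mem_univ y),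
    fun h => ⟨Set.bijOn_univ.2 σ.bijective, fun x _ y _ => h x y⟩⟩

theorem pow_apply_eq_iff {σ : Perm (Fin n)} (h : σ.IsCycleOn Set.univ) (r : Fin n) {i j : ℕ} :
    (σ ^ i) r = (σ ^ j) r ↔ i ≡ j [MOD n] := by
  have h' : σ.IsCycleOn ((Finset.univ : Finset (Fin n)) : Set (Fin n)) := by simpa using h
  simpa using h'.pow_apply_eq_pow_apply (Finset.mem_univ r) (m := i) (n := j)

theorem position_lt {σ : Perm (Fin n)} (h : σ.IsCycleOn Set.univ) (r e : Fin n) :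
    position σ r e < n := by
  have h' : σ.IsCycleOn ((Finset.univ : Finset (Fin n)) : Set (Fin n)) := by simpa using h
  obtain ⟨k, hk, hke⟩ := h'.exists_pow_eq (Finset.mem_univ r) (Finset.mem_univ e)
  refine lt_of_le_of_lt (Nat.sInf_le hke) (by simpa using hk)

theorem position_eq_iff {σ : Perm (Fin n)} (h : σ.IsCycleOn Set.univ) {r e : Fin n} {k : ℕ}
    (hk : k < n) : position σ r e = k ↔ (σ ^ k) r = e := by
  constructor
  · rintro rfl
    exact exists_pow_apply h r e
  · intro he
    have h1 := exists_pow_apply h r e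
    rw [← he, pow_apply_eq_iff h] at h1
    rw [← he]
    exact h1.eq_of_lt_of_lt (position_lt h r _) hk

theorem position_apply {σ : Perm (Fin n)} (h : σ.IsCycleOn Set.univ) (r x : Fin n) :
    position σ r (σ x) ≡ position σ r x + 1 [MOD n] := by
  rw [← pow_apply_eq_iff h r, exists_pow_apply h, pow_succ', Perm.mul_apply, exists_pow_apply h]

/-- Two full cycles are matched by sending each element to the one at the same distance from the
chosen starting point. -/
theorem exists_conj_eq {σ τ : Perm (Fin n)} (hσ : σ.IsCycleOn Set.univ)
    (hτ : τ.IsCycleOn Set.univ) (r r' : Fin n) :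
    ∃ π : Perm (Fin n), π * σ * π⁻¹ = τ ∧ π r = r' := by
  let f : Fin n → Fin n := fun x => (τ ^ position σ r x) r'
  have hf : Function.Injective f := by
    intro x y hxy
    rw [pow_apply_eq_iff hτ] at hxy
    exact (position_inj hσ r).1 (hxy.eq_of_lt_of_lt (position_lt hσ r _) (position_lt hσ r _))
  have hfσ : ∀ x, f (σ x) = τ (f x) := by
    intro x
    change (τ ^ _) r' = τ ((τ ^ _) r')
    rw [← Perm.mul_apply, ← pow_succ', pow_apply_eq_iff hτ]
    exact position_apply hσ r x
  refine ⟨Equiv.ofBijective f (Finite.injective_iff_bijective.1 hf), ?_, ?_⟩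
  · rw [mul_inv_eq_iff_eq_mul]
    ext x
    simp [hfσ]
  · have : position σ r r = 0 := (position_eq_zero hσ).2 rfl
    simp [f, this]

/-- A relabelling that commutes with a full cycle and fixes one point fixes every point. Hence
rooted dipoles have no automorphisms, and classes are counted without weights. -/
theorem eq_one_of_conj_eq {σ π : Perm (Fin n)} (hσ : σ.IsCycleOn Set.univ) {r : Fin n}
    (h : π * σ * π⁻¹ = σ) (hr : π r = r) : π = 1 := by
  ext x
  rw [← exists_pow_apply hσ r x, ← conj_pow_apply, h, hr]
  simp

theorem isCycleOn_inv_iff {σ : Perm (Fin n)} :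
    σ⁻¹.IsCycleOn Set.univ ↔ σ.IsCycleOn Set.univ := by
  simp [isCycleOn_univ_iff]

theorem isCycleOn_finRotate (n : ℕ) : (finRotate n).IsCycleOn Set.univ := by
  rw [isCycleOn_univ_iff]
  match n with
  | 0 => exact fun x => x.elim0
  | 1 => exact fun x y => by rw [Subsingleton.elim x y]
  | n + 2 =>
    intro x y
    refine isCycle_finRotate.sameCycle ?_ ?_ <;>
    · rw [← Perm.mem_support, support_finRotate]
      simp

theorem isCycleOn_up_mul_swap_iff {τ : Perm (Fin n)} {p : Fin n} :
    (up τ * swap p.castSucc (Fin.last n)).IsCycleOn Set.univ ↔ τ.IsCycleOn Set.univ := by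
  set τ' := up τ * swap p.castSucc (Fin.last n) with hτ'
  have hp : τ' p.castSucc = Fin.last n := by simp [hτ']
  have hl : τ' (Fin.last n) = (τ p).castSucc := by simp [hτ']
  have hx : ∀ x, x ≠ p → τ' x.castSucc = (τ x).castSucc := by
    intro x hx
    rw [hτ', Perm.mul_apply, swap_apply_of_ne_of_ne (by simpa using hx) (Fin.castSucc_ne_last x),
      up_castSucc]
  rw [isCycleOn_univ_iff, isCycleOn_univ_iff]
  constructor
  · intro h x y
    -- Collapsing the inserted element onto its successor sends each orbit of the enlarged
    -- permutation into an orbit of `τ`.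
    let f : Fin (n + 1) → Fin n := Fin.lastCases (τ p) id
    have hf : ∀ z, τ.SameCycle (f z) (f (τ' z)) := by
      intro z
      induction z using Fin.lastCases with
      | last => rw [hl]; simp [f, Perm.SameCycle.refl]
      | cast z =>
        by_cases hz : z = p
        · subst hz
          rw [hp]
          simp [f, Perm.SameCycle.refl]
        · rw [hx z hz]
          simp [f, Perm.SameCycle.refl]
    obtain ⟨k, hk⟩ := (h x.castSucc y.castSucc).exists_nat_pow_eq
    have key : ∀ k : ℕ, τ.SameCycle x (f ((τ' ^ k) x.castSucc)) := by
      intro k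
      induction k with
      | zero => simp [f, Perm.SameCycle.refl]
      | succ k ih =>
        rw [pow_succ', Perm.mul_apply]
        exact ih.trans (hf _)
    have := key k
    rw [hk] at this
    simpa [f] using this
  · intro h
    have h1 : ∀ x, τ'.SameCycle x.castSucc (τ x).castSucc := by
      intro x
      by_cases hxp : x = p
      · subst hxp
        exact ⟨2, by rw [zpow_ofNat, pow_two, Perm.mul_apply, hp, hl]⟩
      · exact ⟨1, by rw [zpow_one, hx x hxp]⟩
    have h2 : ∀ x y : Fin n, τ'.SameCycle x.castSucc y.castSucc := by
      intro x y
      obtain ⟨k, rfl⟩ := (h x y).exists_nat_pow_eq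
      induction k with
      | zero => exact Perm.SameCycle.refl _ _
      | succ k ih =>
        rw [pow_succ', Perm.mul_apply]
        exact ih.trans (h1 _)
    have h3 : ∀ z : Fin (n + 1), τ'.SameCycle p.castSucc z := by
      intro z
      induction z using Fin.lastCases with
      | last => exact ⟨1, by rw [zpow_one, hp]⟩
      | cast z => exact h2 p z
    exact fun x y => (h3 x).symm.trans (h3 y)

/-- Edge deletion: `p` is the predecessor of the last element, and it differs from that element
because a full cycle on at least two points has no fixed point. -/
theorem exists_eq_up_mul_swap [NeZero n] {ψ : Perm (Fin (n + 1))} (h : ψ.IsCycleOn Set.univ) :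
    ∃ (τ : Perm (Fin n)) (p : Fin n), ψ = up τ * swap p.castSucc (Fin.last n) := by
  have hne : ψ⁻¹ (Fin.last n) ≠ Fin.last n := by
    intro h1
    have h2 : ∀ k : ℕ, (ψ⁻¹ ^ k) (Fin.last n) = Fin.last n := by
      intro k
      induction k with
      | zero => simp
      | succ k ih => rw [pow_succ', Perm.mul_apply, ih, h1]
    obtain ⟨k, hk⟩ := (isCycleOn_univ_iff.1 (isCycleOn_inv_iff.2 h) (Fin.last n)
      (0 : Fin n).castSucc).exists_nat_pow_eq
    rw [h2] at hk
    exact Fin.castSucc_ne_last _ hk.symm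
  obtain ⟨p, hp⟩ := Fin.exists_castSucc_eq.2 hne
  obtain ⟨τ, hτ⟩ := exists_eq_up (ψ := ψ * swap p.castSucc (Fin.last n)) (by simp [hp])
  exact ⟨τ, p, by rw [← hτ, mul_assoc, swap_mul_self, mul_one]⟩

theorem up_mul_swap_inj {τ τ' : Perm (Fin n)} {p p' : Fin n}
    (h : up τ * swap p.castSucc (Fin.last n) = up τ' * swap p'.castSucc (Fin.last n)) :
    τ = τ' ∧ p = p' := by
  have hp : p = p' := by
    have h1 := congrArg (fun π : Perm (Fin (n + 1)) => π⁻¹ (Fin.last n)) h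
    have h2 : ∀ (τ : Perm (Fin n)) (p : Fin n),
        (up τ * swap p.castSucc (Fin.last n))⁻¹ (Fin.last n) = p.castSucc := by
      intro τ p
      rw [Perm.inv_eq_iff_eq]
      simp
    simp only [h2] at h1
    exact Fin.castSucc_injective n h1
  subst hp
  exact ⟨up_injective (mul_right_cancel h), rfl⟩

theorem swap_mul_up (τ : Perm (Fin n)) (a : Fin n) :
    swap a.castSucc (Fin.last n) * up τ = up τ * swap (τ⁻¹ a).castSucc (Fin.last n) := by
  rw [swap_mul_eq_mul_swap, ← up_inv]
  simp

end FullCycles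

/-! ### Marks and cyclic orders -/

section Marks

variable {n : ℕ}

/-- The mark of the corner `d`: black in the sector from `r` to `s` in the cyclic order `σ`. -/
noncomputable def sectorMark (σ : Perm (Fin n)) (r s d : Fin n) : Bool :=
  open Classical in decide (position σ r d < position σ r s)

/-- The cyclic order `σ` with the last element inserted after `r`. -/
def insertAfter (σ : Perm (Fin n)) (r : Fin n) : Perm (Fin (n + 1)) :=
  up σ * swap r.castSucc (Fin.last n)

theorem isCycleOn_insertAfter {σ : Perm (Fin n)} (h : σ.IsCycleOn Set.univ) (r : Fin n) :
    (insertAfter σ r).IsCycleOn Set.univ := isCycleOn_up_mul_swap_iff.2 h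

/-- One extra step is spent on the new element, immediately after `r`. The bounds on `k` keep the
walk from passing `r` again. -/
theorem insertAfter_pow {σ : Perm (Fin n)} (h : σ.IsCycleOn Set.univ) (r : Fin n) {k : ℕ}
    (hk : k < n) (hk0 : 0 < k) :
    (insertAfter σ r ^ (k + 1)) r.castSucc = ((σ ^ k) r).castSucc := by
  induction k with
  | zero => omega
  | succ k ih =>
    rcases Nat.eq_zero_or_pos k with rfl | hk'
    · simp [insertAfter, pow_two]
    · rw [pow_succ', Perm.mul_apply, ih (by omega) hk', pow_succ' σ, Perm.mul_apply]
      have hne : (σ ^ k) r ≠ r := by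
        intro hr
        have : (σ ^ k) r = (σ ^ 0) r := by simpa using hr
        rw [pow_apply_eq_iff h] at this
        have := this.eq_of_lt_of_lt (by omega) (by omega)
        omega
      rw [insertAfter, Perm.mul_apply, swap_apply_of_ne_of_ne (by simpa using hne)
        (Fin.castSucc_ne_last _), up_castSucc]

theorem position_insertAfter {σ : Perm (Fin n)} (h : σ.IsCycleOn Set.univ) {r d : Fin n}
    (hd : d ≠ r) :
    position (insertAfter σ r) r.castSucc d.castSucc = position σ r d + 1 := by
  have hlt := position_lt h r d
  have hpos : 0 < position σ r d := Nat.pos_of_ne_zero fun h0 => hd ((position_eq_zero h).1 h0)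
  rw [position_eq_iff (isCycleOn_insertAfter h r) (by omega), insertAfter_pow h r hlt hpos,
    exists_pow_apply h]

theorem position_insertAfter_last {σ : Perm (Fin n)} (h : σ.IsCycleOn Set.univ) (r : Fin n) :
    position (insertAfter σ r) r.castSucc (Fin.last n) = 1 := by
  have : 0 < n := r.pos
  rw [position_eq_iff (isCycleOn_insertAfter h r) (by omega)]
  simp [insertAfter]

theorem sectorMark_root {σ : Perm (Fin n)} (h : σ.IsCycleOn Set.univ) {r s : Fin n}
    (hs : s ≠ r) : sectorMark σ r s r = bl := by
  have h0 : position σ r r = 0 := (position_eq_zero h).2 rfl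
  have hpos : 0 < position σ r s := Nat.pos_of_ne_zero fun h0 => hs ((position_eq_zero h).1 h0)
  simp [sectorMark, h0, hpos]

/-- Every old edge other than `r` moves one step away from `r`, including `s`, so comparisons are
preserved. The new edge lies at distance 1, strictly inside the black sector. -/
theorem sectorMark_insertAfter {σ : Perm (Fin n)} (h : σ.IsCycleOn Set.univ) {r s : Fin n}
    (hs : s ≠ r) :
    sectorMark (insertAfter σ r) r.castSucc s.castSucc = extendMark bl (sectorMark σ r s) := by
  have hpos : 0 < position σ r s := Nat.pos_of_ne_zero fun h0 => hs ((position_eq_zero h).1 h0)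
  funext d
  induction d using Fin.lastCases with
  | last =>
    rw [extendMark_last]
    simp [sectorMark, position_insertAfter h hs, position_insertAfter_last h, hpos]
  | cast d =>
    rw [extendMark_castSucc]
    by_cases hd : d = r
    · subst hd
      rw [sectorMark_root h hs, sectorMark_root (isCycleOn_insertAfter h d) (by simpa using hs)]
    · simp [sectorMark, position_insertAfter h hs, position_insertAfter h hd]

end Marks

/-! ### Sums over cyclic orders -/

section Sums

variable {n : ℕ}

open Classical in
/-- The sum of the weights of the dipoles with cyclic order `σ` at the root vertex, root edge `r`,
secondary edge `s`, twice the genus equal to `k`, and no edges in Region 4. -/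
noncomputable def birootedSum (k : ℕ) (σ : Perm (Fin n)) (r s : Fin n) : Coeffs :=
  ∑ ψ : Perm (Fin n) with ψ.IsCycleOn Set.univ ∧ ψ r = s,
    if defect (σ⁻¹ * ψ) = k then weight (σ⁻¹ * ψ) (sectorMark σ r s) r else 0

open Classical in
/-- The sum of the monomials of the face degrees of the dipoles with cyclic order `σ` at the root
vertex and twice the genus equal to `k`. -/
noncomputable def rootedSum (k : ℕ) (σ : Perm (Fin n)) : Coeffs :=
  ∑ ψ : Perm (Fin n) with ψ.IsCycleOn Set.univ,
    if defect (σ⁻¹ * ψ) = k then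
      fMonomial ((Finset.univ : Finset (Cycles (σ⁻¹ * ψ))).val.map (cyclicWord _ fun _ => wh))
    else 0

-- Deleting the edge next to the root at the root vertex is a bijection from the enlarged
-- permutations to pairs of a smaller `ψ` and an insertion point `p`. The constraint `ψ r = s`
-- survives exactly when `p ≠ r`, so no edge enters Region 4.
open Classical in
theorem birootedSum_insertAfter_aux (k : ℕ) {σ : Perm (Fin n)} (h : σ.IsCycleOn Set.univ)
    {r s : Fin n} (hs : s ≠ r) :
    birootedSum k (insertAfter σ r) r.castSucc s.castSucc =
      ∑ ψ : Perm (Fin n) with ψ.IsCycleOn Set.univ ∧ ψ r = s,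
        ((if defect (σ⁻¹ * ψ) = k then cut (weight (σ⁻¹ * ψ) (sectorMark σ r s) r) else 0) +
          if defect (σ⁻¹ * ψ) + 2 = k then join (weight (σ⁻¹ * ψ) (sectorMark σ r s) r) else 0) := by
  have : NeZero n := ⟨r.pos.ne'⟩
  simp only [← sum_insertEdge _ _ _ (sectorMark_root h hs)]
  rw [Finset.sum_sigma', birootedSum]
  symm
  have hfact : ∀ (ψ : Perm (Fin n)) (p : Fin n), (insertAfter σ r)⁻¹ *
      (up ψ * swap p.castSucc (Fin.last n)) = insertEdge (σ⁻¹ * ψ) r p := by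
    intro ψ p
    rw [insertAfter, insertEdge, up_mul, up_inv, mul_inv_rev, swap_inv]
    simp only [mul_assoc]
  refine Finset.sum_bij (fun a _ => up a.1 * swap a.2.castSucc (Fin.last n)) ?_ ?_ ?_ ?_
  · rintro ⟨ψ, p⟩ ha
    simp only [Finset.mem_sigma, Finset.mem_filter, Finset.mem_univ, true_and,
      Finset.mem_erase, and_true] at ha ⊢
    refine ⟨isCycleOn_up_mul_swap_iff.2 ha.1.1, ?_⟩
    rw [Perm.mul_apply, swap_apply_of_ne_of_ne (by simpa using ha.2.symm)
      (Fin.castSucc_ne_last _), up_castSucc, ha.1.2]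
  · rintro ⟨ψ, p⟩ _ ⟨ψ', p'⟩ _ heq
    obtain ⟨rfl, rfl⟩ := up_mul_swap_inj heq
    rfl
  · intro ψ hψ
    simp only [Finset.mem_filter, Finset.mem_univ, true_and] at hψ
    obtain ⟨τ, p, rfl⟩ := exists_eq_up_mul_swap hψ.1
    have hpr : p ≠ r := by
      rintro rfl
      have := hψ.2
      simp at this
      exact Fin.castSucc_ne_last _ this.symm
    refine ⟨⟨τ, p⟩, ?_, rfl⟩
    simp only [Finset.mem_sigma, Finset.mem_filter, Finset.mem_univ, true_and,
      Finset.mem_erase, and_true]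
    refine ⟨⟨isCycleOn_up_mul_swap_iff.1 hψ.1, ?_⟩, hpr⟩
    have := hψ.2
    rw [Perm.mul_apply, swap_apply_of_ne_of_ne (by simpa using hpr.symm)
      (Fin.castSucc_ne_last _), up_castSucc] at this
    exact Fin.castSucc_injective n this
  · rintro ⟨ψ, p⟩ _
    simp only [hfact, sectorMark_insertAfter h hs]

theorem birootedSum_insertAfter {σ : Perm (Fin n)} (h : σ.IsCycleOn Set.univ)
    {r s : Fin n} (hs : s ≠ r) (k : ℕ) :
    birootedSum (k + 2) (insertAfter σ r) r.castSucc s.castSucc =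
      cut (birootedSum (k + 2) σ r s) + join (birootedSum k σ r s) := by
  classical
  rw [birootedSum_insertAfter_aux (k + 2) h hs, Finset.sum_add_distrib, birootedSum, birootedSum,
    map_sum, map_sum]
  simp only [add_left_inj, apply_ite cut, apply_ite join, map_zero]

theorem birootedSum_zero_insertAfter {σ : Perm (Fin n)} (h : σ.IsCycleOn Set.univ)
    {r s : Fin n} (hs : s ≠ r) :
    birootedSum 0 (insertAfter σ r) r.castSucc s.castSucc = cut (birootedSum 0 σ r s) := by
  classical
  rw [birootedSum_insertAfter_aux 0 h hs, birootedSum, map_sum]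
  simp [apply_ite cut]

/-! ### Dipoles without b-edges. -/

/-- The cyclic order `σ` with the last element inserted before `r`. -/
def insertBefore (σ : Perm (Fin n)) (r : Fin n) : Perm (Fin (n + 1)) :=
  swap r.castSucc (Fin.last n) * up σ

theorem isCycleOn_insertBefore_iff {σ : Perm (Fin n)} {r : Fin n} :
    (insertBefore σ r).IsCycleOn Set.univ ↔ σ.IsCycleOn Set.univ := by
  rw [insertBefore, swap_mul_up, isCycleOn_up_mul_swap_iff]

theorem position_insertBefore {σ : Perm (Fin n)} (h : σ.IsCycleOn Set.univ) (r : Fin n) :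
    position (insertBefore σ r) (Fin.last n) r.castSucc = 1 := by
  have : 0 < n := r.pos
  rw [position_eq_iff (isCycleOn_insertBefore_iff.2 h) (by omega)]
  simp [insertBefore]

theorem exists_presentation (φ : Perm (Fin n)) : ∃ L, Presents φ L := by
  cases n with
  | zero => exact ⟨0, by simp, by simp, by simp⟩
  | succ n =>
    obtain ⟨t, L, h⟩ := exists_presents φ 0
    exact ⟨_, h⟩

theorem weight_up (φ : Perm (Fin n)) :
    weight (up φ) (extendMark bl fun _ => wh) (Fin.last n) = gVar [bl] *
      fMonomial ((Finset.univ : Finset (Cycles φ)).val.map (cyclicWord φ fun _ => wh)) := by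
  obtain ⟨L, hL⟩ := exists_presentation φ
  rw [hL.up.weight_eq, map_map_extendMark, hL.map_cyclicWord, fMonomial, Multiset.map_map]
  simp

theorem defect_up (φ : Perm (Fin n)) : defect (up φ) = defect φ := by
  obtain ⟨L, hL⟩ := exists_presentation φ
  rw [hL.defect_eq, hL.up.defect_eq]
  simp

/-- The new root edge runs parallel to the secondary edge `r`, so the face permutation only gains a
fixed point. That digon is the root face, with word •; the black sector contains no other corner, so
the rest is white. -/
theorem birootedSum_insertBefore (k : ℕ) {σ : Perm (Fin n)} (h : σ.IsCycleOn Set.univ)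
    (r : Fin n) :
    birootedSum k (insertBefore σ r) (Fin.last n) r.castSucc = gVar [bl] * rootedSum k σ := by
  classical
  have hmark : sectorMark (insertBefore σ r) (Fin.last n) r.castSucc =
      extendMark bl fun _ => wh := by
    funext d
    induction d using Fin.lastCases with
    | last => rw [extendMark_last, sectorMark_root (isCycleOn_insertBefore_iff.2 h)
        (Fin.castSucc_ne_last r)]
    | cast d =>
      have : position (insertBefore σ r) (Fin.last n) d.castSucc ≠ 0 := fun h0 =>
        Fin.castSucc_ne_last d ((position_eq_zero (isCycleOn_insertBefore_iff.2 h)).1 h0)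
      simp [sectorMark, position_insertBefore h, this]
  rw [birootedSum, rootedSum, Finset.mul_sum]
  symm
  have hfact : ∀ ψ : Perm (Fin n), (insertBefore σ r)⁻¹ * insertBefore ψ r = up (σ⁻¹ * ψ) := by
    intro ψ
    rw [insertBefore, insertBefore, up_mul, up_inv]
    group
  refine Finset.sum_bij (fun ψ _ => insertBefore ψ r) ?_ ?_ ?_ ?_
  · intro ψ hψ
    simp only [Finset.mem_filter, Finset.mem_univ, true_and] at hψ ⊢
    exact ⟨isCycleOn_insertBefore_iff.2 hψ, by simp [insertBefore]⟩
  · intro ψ _ ψ' _ heq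
    exact up_injective (mul_left_cancel heq)
  · intro ψ hψ
    simp only [Finset.mem_filter, Finset.mem_univ, true_and] at hψ
    obtain ⟨τ, hτ⟩ := exists_eq_up (ψ := swap r.castSucc (Fin.last n) * ψ) (by simp [hψ.2])
    have hψτ : insertBefore τ r = ψ := by rw [insertBefore, ← hτ, swap_mul_self_mul]
    refine ⟨τ, ?_, hψτ⟩
    simp only [Finset.mem_filter, Finset.mem_univ, true_and]
    rw [← isCycleOn_insertBefore_iff (r := r), hψτ]
    exact hψ.1
  · intro ψ _
    rw [hfact, hmark, weight_up, defect_up, mul_ite, mul_zero]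

end Sums

/-! ### Isomorphism classes and normal forms -/

section Orbits

variable {n : ℕ}

theorem card_position_lt {σ : Perm (Fin n)} (h : σ.IsCycleOn Set.univ) (r s : Fin n) :
    Nat.card {e // 0 < position σ r e ∧ position σ r e < position σ r s} =
      position σ r s - 1 := by
  classical
  have h2 : (Finset.Ioo 0 (position σ r s)).card = position σ r s - 1 := by simp
  rw [Nat.card_eq_fintype_card, Fintype.card_subtype, ← h2]
  refine Finset.card_bij (fun e _ => position σ r e) ?_ ?_ ?_
  · intro e he
    simpa using he
  · intro e _ e' _ hee
    exact (position_inj h r).1 hee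
  · intro k hk
    rw [Finset.mem_Ioo] at hk
    have hp : position σ r ((σ ^ k) r) = k :=
      (position_eq_iff h (hk.2.trans (position_lt h r s))).2 rfl
    exact ⟨(σ ^ k) r, by simpa [hp] using hk, hp⟩

namespace LabelledBirootedDipole

theorem otherPos_secondary_eq_iff (D : LabelledBirootedDipole n) :
    D.otherPos D.secondary + 1 = n ↔ D.otherRot D.secondary = D.root := by
  have hn : 0 < n := D.root.pos
  have h1 := position_apply D.otherRot_cycle D.root D.secondary
  have hlt := position_lt D.otherRot_cycle D.root D.secondary
  rw [← position_eq_zero D.otherRot_cycle]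
  unfold otherPos
  constructor
  · intro h
    rw [h] at h1
    have h2 := position_lt D.otherRot_cycle D.root (D.otherRot D.secondary)
    exact (h1.trans (by simp [Nat.ModEq])).eq_of_lt_of_lt h2 hn
  · intro h
    rw [h] at h1
    have h2 := (Nat.modEq_zero_iff_dvd.1 h1.symm)
    exact le_antisymm hlt (Nat.le_of_dvd (Nat.succ_pos _) h2)

theorem gamma_delta_eq_zero_iff (D : LabelledBirootedDipole n) :
    D.gamma = 0 ∧ D.delta = 0 ↔ D.otherRot D.secondary = D.root := by
  have hn : 0 < n := D.root.pos
  rw [← otherPos_secondary_eq_iff]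
  have hlt : D.otherPos D.secondary < n := position_lt D.otherRot_cycle D.root D.secondary
  unfold gamma delta
  rw [Finite.card_eq_zero_iff, Finite.card_eq_zero_iff, isEmpty_subtype, isEmpty_subtype]
  constructor
  · rintro ⟨h1, h2⟩
    by_contra hne
    -- The edge just before the root edge at the other vertex: unless it is the secondary edge, it
    -- lies in Region 4 and is counted by γ or δ.
    set e := (D.otherRot ^ (n - 1)) D.root with he
    have hpe : D.otherPos e = n - 1 := (position_eq_iff D.otherRot_cycle (by omega)).2 rfl
    have h4 : D.InRegion4 e := by
      unfold InRegion4
      omega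
    have hes : D.rootPos e ≠ D.rootPos D.secondary := by
      intro h
      have : e = D.secondary := (position_inj D.rootRot_cycle D.root).1 h
      rw [InRegion4, this] at h4
      exact lt_irrefl _ h4
    have he0 : 0 < D.rootPos e := by
      refine Nat.pos_of_ne_zero fun h => ?_
      have : e = D.root := (position_eq_zero D.rootRot_cycle).1 h
      have h5 : D.otherPos e = 0 := (position_eq_zero D.otherRot_cycle).2 this
      rw [InRegion4, h5] at h4
      exact Nat.not_lt_zero _ h4
    rcases lt_or_gt_of_ne hes with h | h
    · exact h2 e ⟨⟨he0, h⟩, h4⟩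
    · exact h1 e ⟨h, h4⟩
  · intro h
    have : ∀ e, ¬ D.InRegion4 e := by
      intro e he
      have h5 : D.otherPos e < n := position_lt D.otherRot_cycle D.root e
      unfold InRegion4 at he
      omega
    exact ⟨fun e he => this e he.2, fun e he => this e he.2⟩

theorem beta_eq (D : LabelledBirootedDipole n) (h : D.otherRot D.secondary = D.root) :
    D.beta = D.rootPos D.secondary - 1 := by
  rw [← otherPos_secondary_eq_iff] at h
  rw [rootPos, ← card_position_lt D.rootRot_cycle, beta]
  refine Nat.card_congr (Equiv.subtypeEquivRight fun e => ?_)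
  refine ⟨fun he => he.1, fun he => ⟨he, ?_⟩⟩
  have h5 : D.otherPos e < n := position_lt D.otherRot_cycle D.root e
  have h6 : D.otherPos e ≠ D.otherPos D.secondary := by
    intro h7
    rw [(position_inj D.otherRot_cycle D.root).1 h7] at he
    exact lt_irrefl _ he.2
  have h8 : 0 < D.otherPos e := by
    refine Nat.pos_of_ne_zero fun h7 => ?_
    have h9 : e = D.root := (position_eq_zero D.otherRot_cycle).1 h7
    have h10 := he.1
    rw [(position_eq_zero D.rootRot_cycle).2 h9] at h10
    exact lt_irrefl _ h10
  exact ⟨h8, by omega⟩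

/-- With Region 4 empty, β counts everything in Region 1 and is read off the position of the
secondary edge. The total number of edges then forces α. -/
theorem region_conditions_iff (D : LabelledBirootedDipole n) {i j : ℕ}
    (hn : n = i + j + 1) :
    (D.gamma = 0 ∧ D.delta = 0 ∧ D.alpha + 1 = i ∧ D.beta = j) ↔
      D.otherRot D.secondary = D.root ∧ D.rootPos D.secondary = j + 1 := by
  have hpos : D.rootPos D.secondary ≠ 0 := fun h =>
    D.secondary_ne ((position_eq_zero D.rootRot_cycle).1 h)
  have hc := D.card_edges
  have hgd := D.gamma_delta_eq_zero_iff
  constructor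
  · rintro ⟨h1, h2, h3, h4⟩
    have h5 := hgd.1 ⟨h1, h2⟩
    have := D.beta_eq h5
    exact ⟨h5, by omega⟩
  · rintro ⟨h1, h2⟩
    have := D.beta_eq h1
    obtain ⟨h3, h4⟩ := hgd.2 h1
    exact ⟨h3, h4, by omega, by omega⟩

theorem weight_facePerm (D : LabelledBirootedDipole n) :
    gVar D.rootWord * fMonomial D.nonrootWords =
      weight D.facePerm (sectorMark D.rootRot D.root D.secondary) D.root := rfl

end LabelledBirootedDipole

-- Each class has exactly one representative with root order `σ` and root `r`; the secondary edge is
-- then forced to be `s` by its position. Only the order at the other vertex remains free.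
open Classical in
theorem sum_birootedDipole (k : ℕ) {i j : ℕ} {σ : Perm (Fin (i + j + 1))}
    (h : σ.IsCycleOn Set.univ) {r s : Fin (i + j + 1)} (hs : position σ r s = j + 1) :
    ∑ D : BirootedDipole (i + j + 1) with
        D.gamma = 0 ∧ D.delta = 0 ∧ D.alpha + 1 = i ∧ D.beta = j ∧ D.twiceGenus = k,
        gVar D.rootWord * fMonomial D.nonrootWords = birootedSum k σ r s := by
  have hsr : s ≠ r := by
    rintro rfl
    rw [(position_eq_zero h).2 rfl] at hs
    omega
  rw [birootedSum, ← Finset.sum_filter, Finset.filter_filter]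
  symm
  let mk : ∀ ψ : Perm (Fin (i + j + 1)), ψ.IsCycleOn Set.univ →
      LabelledBirootedDipole (i + j + 1) := fun ψ hψ =>
    { rootRot := σ, otherRot := ψ⁻¹, rootRot_cycle := h,
      otherRot_cycle := isCycleOn_inv_iff.2 hψ, root := r, secondary := s, secondary_ne := hsr }
  refine Finset.sum_bij (fun ψ hψ => (Quotient.mk _ (mk ψ (Finset.mem_filter.1 hψ).2.1.1) :
    BirootedDipole (i + j + 1))) ?_ ?_ ?_ ?_
  · intro ψ hψ
    obtain ⟨-, ⟨h1, h2⟩, h3⟩ := Finset.mem_filter.1 hψ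
    refine Finset.mem_filter.2 ⟨Finset.mem_univ _, ?_⟩
    obtain ⟨a, b, c, d⟩ := ((mk ψ h1).region_conditions_iff rfl).2
      ⟨by change ψ⁻¹ s = r; rw [← h2]; simp, hs⟩
    exact ⟨a, b, c, d, h3⟩
  · intro ψ hψ ψ' hψ' heq
    obtain ⟨π, hπ⟩ := Quotient.exact heq
    have e1 : π * σ * π⁻¹ = σ := congrArg (fun D => D.rootRot) hπ
    have e2 : π * ψ'⁻¹ * π⁻¹ = ψ⁻¹ := congrArg (fun D => D.otherRot) hπ
    have e3 : π r = r := congrArg (fun D => D.root) hπ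
    have := eq_one_of_conj_eq h e1 e3
    subst this
    simpa using e2.symm
  · intro D hD
    induction D using Quotient.inductionOn with
    | h D =>
      obtain ⟨-, a, b, c, d, e⟩ := Finset.mem_filter.1 hD
      obtain ⟨h1, h2⟩ := (D.region_conditions_iff rfl).1 ⟨a, b, c, d⟩
      obtain ⟨π, hπ, hr⟩ := exists_conj_eq D.rootRot_cycle h D.root r
      have hsec : π D.secondary = s := by
        rw [← position_inj h r, hs, ← h2, ← hr, ← hπ]
        exact position_conj π D.rootRot D.root D.secondary
      have hcyc := (π • D).otherRot_cycle
      have hD' : mk ((π • D).otherRot)⁻¹ (isCycleOn_inv_iff.2 hcyc) = π • D := by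
        apply LabelledBirootedDipole.ext
        · exact hπ.symm
        · exact inv_inv _
        · exact hr.symm
        · exact hsec.symm
      refine ⟨((π • D).otherRot)⁻¹, ?_, ?_⟩
      · refine Finset.mem_filter.2 ⟨Finset.mem_univ _, ⟨isCycleOn_inv_iff.2 hcyc, ?_⟩, ?_⟩
        · rw [Perm.inv_eq_iff_eq, ← hr, ← hsec]
          change _ = (π * D.otherRot * π⁻¹) (π D.secondary)
          simp [h1]
        · have h4 : defect (π • D).facePerm = k := by
            have := D.twiceGenus_smul π
            exact this.trans e
          have h5 : (π • D).facePerm = σ⁻¹ * ((π • D).otherRot)⁻¹ := by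
            rw [← hπ]
            rfl
          rw [← h5]
          exact h4
      · refine Quotient.sound ?_
        rw [hD']
        exact ⟨π, rfl⟩
  · intro ψ hψ
    have := (mk ψ (Finset.mem_filter.1 hψ).2.1.1).weight_facePerm
    refine Eq.trans ?_ this.symm
    have h5 : (mk ψ (Finset.mem_filter.1 hψ).2.1.1).facePerm = σ⁻¹ * ψ := by
      change σ⁻¹ * ψ⁻¹⁻¹ = _
      rw [inv_inv]
    rw [h5]

open Classical in
theorem sum_rootedDipole (k : ℕ) {σ : Perm (Fin n)} (h : σ.IsCycleOn Set.univ) (r : Fin n) :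
    ∑ D : RootedDipole n with D.twiceGenus = k, fMonomial D.whiteWords = rootedSum k σ := by
  rw [rootedSum, ← Finset.sum_filter, Finset.filter_filter]
  symm
  let mk : ∀ ψ : Perm (Fin n), ψ.IsCycleOn Set.univ → LabelledDipole n := fun ψ hψ =>
    { rootRot := σ, otherRot := ψ⁻¹, rootRot_cycle := h,
      otherRot_cycle := isCycleOn_inv_iff.2 hψ, root := r }
  refine Finset.sum_bij (fun ψ hψ => (Quotient.mk _ (mk ψ (Finset.mem_filter.1 hψ).2.1) :
    RootedDipole n)) ?_ ?_ ?_ ?_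
  · intro ψ hψ
    exact Finset.mem_filter.2 ⟨Finset.mem_univ _, (Finset.mem_filter.1 hψ).2.2⟩
  · intro ψ hψ ψ' hψ' heq
    obtain ⟨π, hπ⟩ := Quotient.exact heq
    have e1 : π * σ * π⁻¹ = σ := congrArg (fun D => D.rootRot) hπ
    have e2 : π * ψ'⁻¹ * π⁻¹ = ψ⁻¹ := congrArg (fun D => D.otherRot) hπ
    have e3 : π r = r := congrArg (fun D => D.root) hπ
    have := eq_one_of_conj_eq h e1 e3
    subst this
    simpa using e2.symm
  · intro D hD
    induction D using Quotient.inductionOn with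
    | h D =>
      obtain ⟨-, e⟩ := Finset.mem_filter.1 hD
      obtain ⟨π, hπ, hr⟩ := exists_conj_eq D.rootRot_cycle h D.root r
      have hcyc := (π • D).otherRot_cycle
      have hD' : mk ((π • D).otherRot)⁻¹ (isCycleOn_inv_iff.2 hcyc) = π • D := by
        apply LabelledDipole.ext
        · exact hπ.symm
        · exact inv_inv _
        · exact hr.symm
      refine ⟨((π • D).otherRot)⁻¹, ?_, ?_⟩
      · refine Finset.mem_filter.2 ⟨Finset.mem_univ _, isCycleOn_inv_iff.2 hcyc, ?_⟩
        have h4 : defect (π • D).facePerm = k := (D.twiceGenus_smul π).trans e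
        have h5 : (π • D).facePerm = σ⁻¹ * ((π • D).otherRot)⁻¹ := by
          rw [← hπ]
          rfl
        rw [← h5]
        exact h4
      · refine Quotient.sound ?_
        rw [hD']
        exact ⟨π, rfl⟩
  · intro ψ hψ
    have h5 : (mk ψ (Finset.mem_filter.1 hψ).2.1).facePerm = σ⁻¹ * ψ := by
      change σ⁻¹ * ψ⁻¹⁻¹ = _
      rw [inv_inv]
    have key : ∀ φ, φ = σ⁻¹ * ψ → fMonomial ((Finset.univ : Finset (Cycles (σ⁻¹ * ψ))).val.map
        (cyclicWord _ fun _ => wh)) =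
          fMonomial ((Finset.univ : Finset (Cycles φ)).val.map (cyclicWord φ fun _ => wh)) := by
      rintro φ rfl
      rfl
    exact key _ h5

/-- The unnormalized coefficients of `B`. -/
noncomputable def coeffB (k i j : ℕ) : Coeffs :=
  open Classical in ∑ D : BirootedDipole (i + j + 1) with
    D.gamma = 0 ∧ D.delta = 0 ∧ D.alpha + 1 = i ∧ D.beta = j ∧ D.twiceGenus = k,
    gVar D.rootWord * fMonomial D.nonrootWords

/-- The unnormalized coefficients of `A`, without the factor `g_•`. -/
noncomputable def coeffA (k n : ℕ) : Coeffs :=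
  open Classical in ∑ D : RootedDipole n with D.twiceGenus = k, fMonomial D.whiteWords

/-! ### Recurrences in the number of b-edges. -/

theorem coeffB_zero (k j : ℕ) : coeffB k 0 j = 0 := by
  simp [coeffB]

theorem coeffA_edgeless (k : ℕ) : coeffA k 0 = 0 := by
  have : IsEmpty (RootedDipole 0) := ⟨fun D => by
    induction D using Quotient.inductionOn with
    | h D => exact D.root.elim0⟩
  simp [coeffA]

theorem exists_position_eq (n : ℕ) {q : ℕ} (hq : q < n) :
    ∃ (σ : Perm (Fin n)) (r s : Fin n), σ.IsCycleOn Set.univ ∧ position σ r s = q :=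
  have : NeZero n := ⟨by omega⟩
  ⟨finRotate n, 0, ((finRotate n) ^ q) 0, isCycleOn_finRotate n,
    (position_eq_iff (isCycleOn_finRotate n) hq).2 rfl⟩

theorem coeffB_beta_zero (k i : ℕ) : coeffB k i 0 = gVar [bl] * coeffA k i := by
  rcases Nat.eq_zero_or_pos i with rfl | hi
  · simp [coeffB_zero, coeffA_edgeless]
  · have : NeZero i := ⟨hi.ne'⟩
    have hσ := isCycleOn_finRotate i
    rw [coeffB, coeffA, sum_rootedDipole k hσ 0, ← birootedSum_insertBefore k hσ 0]
    exact sum_birootedDipole (j := 0) k (isCycleOn_insertBefore_iff.2 hσ)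
      (position_insertBefore hσ 0)

/-- Any normal form may be used on each side, so the larger one is taken as the smaller one with an
edge inserted after the root. -/
theorem coeffB_succ (k i j : ℕ) :
    coeffB (k + 2) i (j + 1) = cut (coeffB (k + 2) i j) + join (coeffB k i j) := by
  rcases Nat.eq_zero_or_pos i with rfl | hi
  · simp [coeffB_zero]
  obtain ⟨σ, r, s, hσ, hp⟩ := exists_position_eq (i + j + 1) (q := j + 1) (by omega)
  have hs : s ≠ r := fun h => by
    rw [(position_eq_zero hσ).2 h] at hp
    omega
  rw [coeffB, coeffB, coeffB, sum_birootedDipole (k + 2) hσ hp, sum_birootedDipole k hσ hp,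
    ← birootedSum_insertAfter hσ hs]
  exact sum_birootedDipole (j := j + 1) (k + 2) (isCycleOn_insertAfter hσ r)
    ((position_insertAfter hσ hs).trans (by rw [hp]))

theorem coeffB_zero_succ (i j : ℕ) : coeffB 0 i (j + 1) = cut (coeffB 0 i j) := by
  rcases Nat.eq_zero_or_pos i with rfl | hi
  · simp [coeffB_zero]
  obtain ⟨σ, r, s, hσ, hp⟩ := exists_position_eq (i + j + 1) (q := j + 1) (by omega)
  have hs : s ≠ r := fun h => by
    rw [(position_eq_zero hσ).2 h] at hp
    omega
  rw [coeffB, coeffB, sum_birootedDipole 0 hσ hp, ← birootedSum_zero_insertAfter hσ hs]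
  exact sum_birootedDipole (j := j + 1) 0 (isCycleOn_insertAfter hσ r)
    ((position_insertAfter hσ hs).trans (by rw [hp]))

end Orbits

/-! ### Dipoles of small genus -/

section SmallGenus

theorem multiset_eq_of_sum_eq_card {M : Multiset ℕ} (hpos : ∀ a ∈ M, 0 < a)
    (h : M.sum = M.card) : M = Multiset.replicate M.card 1 := by
  rw [Multiset.eq_replicate]
  refine ⟨rfl, fun b hb => ?_⟩
  obtain ⟨M', rfl⟩ := Multiset.exists_cons_of_mem hb
  have h1 := hpos b hb
  have h2 : M'.card ≤ M'.sum := by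
    simpa using Multiset.card_nsmul_le_sum (s := M') (a := 1) fun x hx =>
      hpos x (Multiset.mem_cons_of_mem hx)
  simp only [Multiset.sum_cons, Multiset.card_cons] at h
  omega

theorem exists_two_le {M : Multiset ℕ} (hpos : ∀ a ∈ M, 0 < a) (h : M.card < M.sum) :
    ∃ a M', M = a ::ₘ M' ∧ 2 ≤ a ∧ M'.card ≤ M'.sum := by
  by_contra! hcon
  have hle : M.sum ≤ M.card := by
    have : ∀ a ∈ M, a ≤ 1 := by
      intro a ha
      obtain ⟨M', rfl⟩ := Multiset.exists_cons_of_mem ha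
      by_contra! ha2
      have h2 : M'.card ≤ M'.sum := by
        simpa using Multiset.card_nsmul_le_sum (s := M') (a := 1) fun x hx =>
          hpos x (Multiset.mem_cons_of_mem hx)
      exact absurd (hcon a M' rfl ha2) (by omega)
    simpa using Multiset.sum_le_card_nsmul M 1 this
  omega

/-- The excesses of the parts over 1 add up to 2, so either one part has excess 2 or two parts have
excess 1. -/
theorem multiset_classification {M : Multiset ℕ} (hpos : ∀ a ∈ M, 0 < a) {n : ℕ}
    (hsum : M.sum = n) (hcard : M.card + 2 = n) :
    M = 3 ::ₘ Multiset.replicate (n - 3) 1 ∨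
      (M = 2 ::ₘ 2 ::ₘ Multiset.replicate (n - 4) 1 ∧ 4 ≤ n) := by
  obtain ⟨a, M', rfl, ha, hM'⟩ := exists_two_le hpos (by omega)
  have hpos' : ∀ a ∈ M', 0 < a := fun x hx => hpos x (Multiset.mem_cons_of_mem hx)
  simp only [Multiset.sum_cons, Multiset.card_cons] at hsum hcard
  by_cases h3 : a = 3
  · left
    have := multiset_eq_of_sum_eq_card hpos' (by omega)
    rw [this, h3, show M'.card = n - 3 by omega]
  · right
    obtain ⟨b, M'', rfl, hb, hM''⟩ := exists_two_le hpos' (by omega)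
    have hpos'' : ∀ a ∈ M'', 0 < a := fun x hx => hpos' x (Multiset.mem_cons_of_mem hx)
    simp only [Multiset.sum_cons, Multiset.card_cons] at hsum hcard hM'
    have := multiset_eq_of_sum_eq_card hpos'' (by omega)
    refine ⟨?_, by omega⟩
    rw [this, show M''.card = n - 4 by omega, show a = 2 by omega, show b = 2 by omega]

variable {n : ℕ}

/-- The product of the `f_(∘^l)` over the parts `l` of `M`. -/
noncomputable def whiteMonomial (M : Multiset ℕ) : Coeffs :=
  (M.map fun l => fVar (List.replicate l wh : List Bool)).prod

theorem map_whiteWord (L : Multiset (List (Fin n))) :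
    fMonomial (L.map fun l => ((l.map fun _ => wh : List Bool) : Cycle Bool)) =
      whiteMonomial (L.map List.length) := by
  rw [fMonomial, whiteMonomial, Multiset.map_map, Multiset.map_map]
  congr 1
  refine Multiset.map_congr rfl fun l _ => ?_
  simp

theorem RootedDipole.halfFaceDegrees_spec (D : RootedDipole n) :
    D.halfFaceDegrees.sum = n ∧ D.halfFaceDegrees.card ≤ n ∧
      D.twiceGenus = n - D.halfFaceDegrees.card ∧ (∀ a ∈ D.halfFaceDegrees, 0 < a) ∧
      fMonomial D.whiteWords = whiteMonomial D.halfFaceDegrees := by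
  induction D using Quotient.inductionOn with
  | h D =>
    obtain ⟨L, hL⟩ := exists_presentation D.facePerm
    have hw : D.whiteWords = L.map fun l => ((l.map fun _ => wh : List Bool) : Cycle Bool) :=
      hL.map_cyclicWord fun _ => wh
    have hh : RootedDipole.halfFaceDegrees (Quotient.mk _ D) = L.map List.length := by
      change D.whiteWords.map Cycle.length = _
      rw [hw, Multiset.map_map]
      refine Multiset.map_congr rfl fun l _ => ?_
      simp
    rw [hh, Multiset.card_map]
    refine ⟨hL.sum_length, hL.card_le, hL.defect_eq, ?_, ?_⟩
    · intro a ha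
      obtain ⟨l, hl, rfl⟩ := Multiset.mem_map.1 ha
      exact List.length_pos_iff.2 (hL.ne_nil l hl)
    · rw [← map_whiteWord, ← hw]
      rfl

theorem eq_one_of_defect_eq_zero {φ : Perm (Fin n)} (h : defect φ = 0) : φ = 1 := by
  obtain ⟨L, hL⟩ := exists_presentation φ
  have h1 := hL.card_le
  have h2 := hL.defect_eq
  have h3 : L.map List.length = Multiset.replicate (L.map List.length).card 1 := by
    refine multiset_eq_of_sum_eq_card ?_ (by rw [hL.sum_length, Multiset.card_map]; omega)
    intro a ha
    obtain ⟨l, hl, rfl⟩ := Multiset.mem_map.1 ha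
    exact List.length_pos_iff.2 (hL.ne_nil l hl)
  ext x
  have hx : x ∈ (L.map fun l : List (Fin n) => (l : Multiset (Fin n))).sum := by
    rw [hL.sum_eq]
    exact Finset.mem_univ x
  obtain ⟨s, hs, hxs⟩ := Multiset.mem_join.1 hx
  obtain ⟨l, hl, rfl⟩ := Multiset.mem_map.1 hs
  have h4 : l.length = 1 := by
    have := Multiset.mem_map_of_mem List.length hl
    rw [h3] at this
    exact Multiset.eq_of_mem_replicate this
  obtain ⟨y, rfl⟩ := List.length_eq_one_iff.1 h4
  have h5 : x = y := by simpa using hxs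
  subst h5
  simp [hL.fixed_of_singleton hl]

theorem presents_one (n : ℕ) :
    Presents (1 : Perm (Fin n)) ((Finset.univ : Finset (Fin n)).val.map fun x => [x]) := by
  refine ⟨?_, ?_, ?_⟩
  · rw [Multiset.map_map]
    exact Multiset.sum_map_singleton _
  · intro l hl
    obtain ⟨x, -, rfl⟩ := Multiset.mem_map.1 hl
    simp
  · intro l hl
    obtain ⟨x, -, rfl⟩ := Multiset.mem_map.1 hl
    simp

theorem coeffA_zero (hn : 0 < n) : coeffA 0 n = fVar ([wh] : List Bool) ^ n := by
  have : NeZero n := ⟨hn.ne'⟩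
  have hσ := isCycleOn_finRotate n
  rw [coeffA, sum_rootedDipole 0 hσ 0, rootedSum, Finset.sum_eq_single (finRotate n)]
  · rw [inv_mul_cancel, if_pos (by simp [(presents_one n).defect_eq]),
      (presents_one n).map_cyclicWord, map_whiteWord, whiteMonomial,
      Multiset.map_map, Multiset.map_map]
    change ∏ _x : Fin n, fVar ([wh] : List Bool) = _
    simp
  · intro ψ _ hψ
    refine if_neg fun h => hψ ?_
    exact (inv_mul_eq_one.1 (eq_one_of_defect_eq_zero h)).symm
  · intro h
    simp [hσ] at h

open Classical in
theorem sum_halfFaceDegrees_eq (M : Multiset ℕ) (c : Coeffs) :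
    ∑ D : RootedDipole n, (if D.halfFaceDegrees = M then c else 0) = (psi n M : ℚ) • c := by
  rw [← Finset.sum_filter, Finset.sum_const, psi, Nat.card_eq_fintype_card, Fintype.card_subtype,
    Nat.cast_smul_eq_nsmul]

theorem coeffA_two (n : ℕ) : coeffA 2 n =
    (if 3 ≤ n then (psi3 n : ℚ) • (fVar ([wh, wh, wh] : List Bool) *
      fVar ([wh] : List Bool) ^ (n - 3)) else 0) +
    if 4 ≤ n then (psi22 n : ℚ) • (fVar ([wh, wh] : List Bool) ^ 2 *
      fVar ([wh] : List Bool) ^ (n - 4)) else 0 := by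
  classical
  have h3 : whiteMonomial (3 ::ₘ Multiset.replicate (n - 3) 1) =
      fVar ([wh, wh, wh] : List Bool) * fVar ([wh] : List Bool) ^ (n - 3) := by
    simp [whiteMonomial]
  have h22 : whiteMonomial (2 ::ₘ 2 ::ₘ Multiset.replicate (n - 4) 1) =
      fVar ([wh, wh] : List Bool) ^ 2 * fVar ([wh] : List Bool) ^ (n - 4) := by
    simp [whiteMonomial, pow_two, mul_assoc]
  have hsplit : ∀ D : RootedDipole n, (if D.twiceGenus = 2 then fMonomial D.whiteWords else 0) =
      (if 3 ≤ n then (if D.halfFaceDegrees = 3 ::ₘ Multiset.replicate (n - 3) 1 then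
        fVar ([wh, wh, wh] : List Bool) * fVar ([wh] : List Bool) ^ (n - 3) else 0) else 0) +
      if 4 ≤ n then (if D.halfFaceDegrees = 2 ::ₘ 2 ::ₘ Multiset.replicate (n - 4) 1 then
        fVar ([wh, wh] : List Bool) ^ 2 * fVar ([wh] : List Bool) ^ (n - 4) else 0) else 0 := by
    intro D
    obtain ⟨s1, s2, s3, s4, s5⟩ := D.halfFaceDegrees_spec
    rw [s5]
    have hne : (3 ::ₘ Multiset.replicate (n - 3) 1 : Multiset ℕ) ≠
        2 ::ₘ 2 ::ₘ Multiset.replicate (n - 4) 1 := by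
      intro h
      have : 3 ∈ 2 ::ₘ 2 ::ₘ Multiset.replicate (n - 4) 1 := h ▸ Multiset.mem_cons_self _ _
      simp [Multiset.mem_replicate] at this
    by_cases hg : D.twiceGenus = 2
    · rw [if_pos hg]
      rcases multiset_classification s4 s1 (by omega) with h | ⟨h, h4⟩
      · have hn : 3 ≤ n := by
          rw [← s1, h]
          simp
        rw [if_pos hn, h, if_pos rfl, if_neg hne, h3]
        simp
      · rw [if_pos h4, h, if_pos rfl, if_neg hne.symm, h22]
        simp
    · rw [if_neg hg]
      -- Such a sequence has `n - 2` parts and would force genus one; the bound on `n` keeps the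
      -- truncated subtraction honest.
      have e1 : 3 ≤ n → D.halfFaceDegrees ≠ 3 ::ₘ Multiset.replicate (n - 3) 1 := by
        intro hn h
        rw [h] at s3
        simp at s3
        omega
      have e2 : 4 ≤ n → D.halfFaceDegrees ≠ 2 ::ₘ 2 ::ₘ Multiset.replicate (n - 4) 1 := by
        intro hn h
        rw [h] at s3
        simp at s3
        omega
      by_cases a : 3 ≤ n <;> by_cases b : 4 ≤ n
      · simp [e1 a, e2 b]
      · simp [e1 a, b]
      · omega
      · simp [a, b]
  rw [coeffA, Finset.sum_filter, Finset.sum_congr rfl fun D _ => hsplit D, Finset.sum_add_distrib]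
  congr 1
  · split_ifs
    · exact sum_halfFaceDegrees_eq _ _
    · simp
  · split_ifs
    · exact sum_halfFaceDegrees_eq _ _
    · simp

end SmallGenus

/-! ### Derivations on series -/

section SeriesDerivations

/-- A derivation applied to the coefficients of a power series. -/
noncomputable def mapDeriv {A : Type*} [CommRing A] [Algebra ℚ A] (D : Derivation ℚ A A) :
    Derivation ℚ (PowerSeries A) (PowerSeries A) :=
  Derivation.mk'
    { toFun := fun F => PowerSeries.mk fun n => D (PowerSeries.coeff n F)
      map_add' := fun F G => by ext n; simp
      map_smul' := fun c F => by ext n; simp }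
    fun F G => by
      rw [smul_eq_mul, smul_eq_mul, mul_comm G]
      ext n
      simp only [LinearMap.coe_mk, AddHom.coe_mk, PowerSeries.coeff_mk, PowerSeries.coeff_mul,
        map_add, map_sum, Derivation.leibniz, smul_eq_mul, Finset.sum_add_distrib]
      congr 1
      exact Finset.sum_congr rfl fun p _ => mul_comm _ _

section

variable {A : Type*} [CommRing A] [Algebra ℚ A] (D : Derivation ℚ A A)

@[simp] theorem coeff_mapDeriv (n : ℕ) (F : PowerSeries A) :
    PowerSeries.coeff n (mapDeriv D F) = D (PowerSeries.coeff n F) := by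
  change PowerSeries.coeff n (PowerSeries.mk fun n => D (PowerSeries.coeff n F)) = _
  rw [PowerSeries.coeff_mk]

@[simp] theorem mapDeriv_C (a : A) : mapDeriv D (PowerSeries.C a) = PowerSeries.C (D a) := by
  ext n
  rw [coeff_mapDeriv, PowerSeries.coeff_C, PowerSeries.coeff_C]
  split_ifs <;> simp

@[simp] theorem mapDeriv_X : mapDeriv D PowerSeries.X = 0 := by
  ext n
  rw [coeff_mapDeriv, PowerSeries.coeff_X]
  split_ifs <;> simp

end

variable {A : Type*} [CommRing A]

/-- The power series with coefficients in `S`. -/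
def coeffsIn (S : Subsemiring A) : Subsemiring (PowerSeries A) where
  carrier := {F | ∀ n, PowerSeries.coeff n F ∈ S}
  mul_mem' := fun {F G} hF hG n => by
    rw [PowerSeries.coeff_mul]
    exact sum_mem fun p _ => mul_mem (hF _) (hG _)
  one_mem' := fun n => by
    rw [PowerSeries.coeff_one]
    split_ifs
    · exact one_mem S
    · exact zero_mem S
  add_mem' := fun {F G} hF hG n => by
    rw [map_add]
    exact add_mem (hF n) (hG n)
  zero_mem' := fun n => by
    rw [map_zero]
    exact zero_mem S

theorem C_mem_coeffsIn {S : Subsemiring A} {a : A} (ha : a ∈ S) :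
    PowerSeries.C a ∈ coeffsIn S := fun n => by
  rw [PowerSeries.coeff_C]
  split_ifs
  · exact ha
  · exact zero_mem S

theorem X_mem_coeffsIn (S : Subsemiring A) : PowerSeries.X ∈ coeffsIn S := fun n => by
  rw [PowerSeries.coeff_X]
  split_ifs
  · exact one_mem S
  · exact zero_mem S

end SeriesDerivations

/-! ### The series in `x` and `y` -/

section SeriesXY

/-- The constant series `p`. -/
noncomputable def constXY (p : Coeffs) : SeriesXY := PowerSeries.C (PowerSeries.C p)

/-- `g_R` as a series in `x` and `y`. -/
noncomputable def gXY (R : List Bool) : SeriesXY := constXY (gVar R)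

/-- `φ_k` as a series in `x` and `y`. -/
noncomputable def phiXY (k : ℕ) : SeriesXY := PowerSeries.C (phi k)

/-- `∂/∂y - C'` on series in `x` and `y`. -/
noncomputable def heat : Derivation ℚ SeriesXY SeriesXY :=
  mapDeriv ((PowerSeries.derivative Coeffs).restrictScalars ℚ - mapDeriv cut)

/-- `joinWith R`, coefficientwise. -/
noncomputable def joinWithXY (R : List Bool) : Derivation ℚ SeriesXY SeriesXY :=
  mapDeriv (mapDeriv (joinWith R))

/-- `join`, coefficientwise. -/
noncomputable def joinXY (F : SeriesXY) : SeriesXY :=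
  PowerSeries.mk fun i => PowerSeries.mk fun j =>
    join (PowerSeries.coeff j (PowerSeries.coeff i F))

/-- The series in the `f_(S)` only. -/
noncomputable def fSeries : Subsemiring SeriesXY := coeffsIn (coeffsIn fAlgebra.toSubsemiring)

theorem joinXY_add (F G : SeriesXY) : joinXY (F + G) = joinXY F + joinXY G := by
  ext1 i
  ext1 j
  simp only [joinXY, PowerSeries.coeff_mk, map_add]

theorem joinXY_gXY_mul (R : List Bool) {F : SeriesXY} (hF : F ∈ fSeries) :
    joinXY (gXY R * F) = joinWithXY R F := by
  ext1 i
  ext1 j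
  rw [joinXY, PowerSeries.coeff_mk, PowerSeries.coeff_mk, joinWithXY, coeff_mapDeriv,
    coeff_mapDeriv, gXY, constXY, PowerSeries.coeff_C_mul, PowerSeries.coeff_C_mul]
  exact join_gVar_mul R (hF i j)

theorem coeff_heat (F : SeriesXY) (i j : ℕ) :
    PowerSeries.coeff j (PowerSeries.coeff i (heat F)) =
      ((j : ℚ) + 1) • PowerSeries.coeff (j + 1) (PowerSeries.coeff i F) -
        cut (PowerSeries.coeff j (PowerSeries.coeff i F)) := by
  rw [heat, coeff_mapDeriv, Derivation.sub_apply, map_sub, coeff_mapDeriv]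
  congr 1
  change PowerSeries.coeff j (PowerSeries.derivative Coeffs _) = _
  rw [PowerSeries.coeff_derivative, MvPolynomial.smul_eq_C_mul]
  simp [mul_comm]

/-- The substitution `y = 0`. -/
noncomputable def atZero : SeriesXY →+* PowerSeries Coeffs :=
  PowerSeries.map PowerSeries.constantCoeff

theorem coeff_atZero (F : SeriesXY) (i : ℕ) :
    PowerSeries.coeff i (atZero F) = PowerSeries.coeff 0 (PowerSeries.coeff i F) := by
  simp [atZero]

/-- The equation expresses `j + 1` times the coefficient of y^{j+1} through that of y^j, and `j + 1`
is invertible over ℚ. -/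
theorem eq_of_heat_eq {F G : SeriesXY} (h : heat F = heat G) (h0 : atZero F = atZero G) :
    F = G := by
  ext1 i
  ext1 j
  induction j with
  | zero => rw [← coeff_atZero, h0, coeff_atZero]
  | succ j ih =>
    have h1 := coeff_heat F i j
    rw [h, coeff_heat, ih, sub_left_inj] at h1
    have hj : ((j : ℚ) + 1) ≠ 0 := by positivity
    exact (smul_right_injective Coeffs hj h1).symm

theorem heat_constXY (p : Coeffs) : heat (constXY p) = - constXY (cut p) := by
  rw [heat, constXY, mapDeriv_C, Derivation.sub_apply, mapDeriv_C]
  simp [constXY]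

theorem heat_fXY (S : List Bool) : heat (fXY S) = 0 := by
  have := heat_constXY (fVar S)
  rw [cut_fVar] at this
  exact this.trans (by simp [constXY])

theorem heat_xXY : heat xXY = 0 := mapDeriv_X _

theorem heat_tauXY (R : List Bool) (k : ℕ) : heat (tauXY R k) = gXY (bl :: R) * phiXY k := by
  have h := (existsUnique_isPreimage (PowerSeries.C (gVar (bl :: R)) * phi k)).choose_spec.1.1
  rw [heat, tauXY, mapDeriv_C, gXY, phiXY, constXY, ← map_mul]
  congr 1

theorem atZero_tauXY (R : List Bool) (k : ℕ) : atZero (tauXY R k) = 0 := by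
  have h := (existsUnique_isPreimage (PowerSeries.C (gVar (bl :: R)) * phi k)).choose_spec.1.2
  rw [tauXY, atZero, PowerSeries.map_C]
  exact (congrArg _ h).trans (map_zero _)

/-! ### The join operator and ∂/∂y − C' on the building blocks. -/

theorem joinWith_fVar_singleton (R : List Bool) (b : Bool) :
    joinWith R (fVar ([b] : List Bool)) = gVar (R ++ [bl, b]) := by
  rw [joinWith_fVar, sum_lists (by simp)]
  simp

theorem joinWithXY_fXY (R S : List Bool) : joinWithXY R (fXY S) =
    constXY (((S : Cycle Bool).lists.map fun l => gVar (R ++ bl :: l)).sum) := by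
  rw [joinWithXY, fXY, mapDeriv_C, mapDeriv_C, joinWith_fVar, constXY]

theorem joinWithXY_xXY (R : List Bool) : joinWithXY R xXY = 0 := mapDeriv_X _

theorem coeff_sumFrom (N : ℕ) (c : ℕ → ℕ) (n : ℕ) : PowerSeries.coeff n (sumFrom N c) =
    if N ≤ n then PowerSeries.C (((c n : ℚ) / n.factorial) • fVar ([wh] : List Bool) ^ (n - N))
    else 0 := by
  rw [sumFrom, PowerSeries.coeff_mk, ← map_pow]
  split_ifs
  · ext1 j
    rw [PowerSeries.coeff_smul, PowerSeries.coeff_C, PowerSeries.coeff_C]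
    split_ifs <;> simp
  · rfl

theorem expXF_eq_sumFrom : expXF = sumFrom 0 fun _ => 1 := by
  ext1 n
  rw [expXF, sumFrom, PowerSeries.coeff_rescale, PowerSeries.coeff_exp, PowerSeries.coeff_mk,
    if_pos (Nat.zero_le n), Algebra.smul_def, mul_comm]
  simp

theorem heat_sumFrom (N : ℕ) (c : ℕ → ℕ) : heat (sumFrom N c) = 0 := by
  ext1 n
  rw [heat, coeff_mapDeriv, coeff_sumFrom]
  split_ifs
  · rw [Derivation.sub_apply, mapDeriv_C,
      cut_eq_zero_of_mem (Subalgebra.smul_mem _ (pow_mem (fVar_mem _) _) _)]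
    simp
  · simp

theorem sumFrom_mem (N : ℕ) (c : ℕ → ℕ) : sumFrom N c ∈ fSeries := fun n => by
  rw [coeff_sumFrom]
  split_ifs
  · exact C_mem_coeffsIn (Subalgebra.smul_mem _ (pow_mem (fVar_mem _) _) _)
  · exact zero_mem _

theorem fXY_mem (S : List Bool) : fXY S ∈ fSeries :=
  C_mem_coeffsIn (C_mem_coeffsIn (fVar_mem _))

/-- Only f_∘ occurs in the sum, and differentiating its power `n - N` brings that exponent down as a
factor. The term `n = N` disappears, hence the lower limit `N + 1`. -/
theorem joinWithXY_sumFrom (R : List Bool) (N : ℕ) (c : ℕ → ℕ) :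
    joinWithXY R (sumFrom N c) =
      gXY (R ++ [bl, wh]) * sumFrom (N + 1) fun n => (n - N) * c n := by
  ext1 n
  rw [joinWithXY, coeff_mapDeriv, gXY, constXY, PowerSeries.coeff_C_mul, coeff_sumFrom,
    coeff_sumFrom]
  rcases lt_trichotomy n N with h | rfl | h
  · rw [if_neg (by omega), if_neg (by omega)]
    simp
  · rw [if_pos le_rfl, if_neg (by omega), mapDeriv_C]
    simp
  · rw [if_pos (by omega), if_pos (by omega), mapDeriv_C, ← map_mul]
    congr 1
    obtain ⟨d, rfl⟩ : ∃ d, n = N + 1 + d := ⟨n - (N + 1), by omega⟩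
    rw [show N + 1 + d - N = d + 1 by omega, show N + 1 + d - (N + 1) = d by omega,
      Derivation.map_smul, Derivation.leibniz_pow, joinWith_fVar_singleton]
    rw [Nat.cast_mul, mul_div_assoc, mul_comm, ← smul_smul]
    simp only [MvPolynomial.smul_eq_C_mul, smul_eq_mul, nsmul_eq_mul]
    push_cast
    simp
    ring

theorem aeval_hsymm_const (k m : ℕ) (c : Coeffs) :
    MvPolynomial.aeval (fun _ : Fin k => c) (MvPolynomial.hsymm (Fin k) ℚ m) =
      (k.multichoose m : ℚ) • c ^ m := by
  rw [MvPolynomial.hsymm, map_sum]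
  have : ∀ s : Sym (Fin k) m, MvPolynomial.aeval (fun _ : Fin k => c)
      (s.1.map (MvPolynomial.X : Fin k → MvPolynomial (Fin k) ℚ)).prod = c ^ m := by
    intro s
    rw [map_multiset_prod, Multiset.map_map]
    simp [Function.comp_def]
  rw [Finset.sum_congr rfl fun s _ => this s, Finset.sum_const, Finset.card_univ,
    Sym.card_sym_eq_multichoose, Fintype.card_fin, Nat.cast_smul_eq_nsmul]

theorem coeff_phi (k n : ℕ) : PowerSeries.coeff n (phi k) =
    if k ≤ n then ((k.multichoose (n - k) : ℚ) / n.factorial) •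
      fVar ([bl] : List Bool) ^ (n - k) else 0 := by
  rw [phi, phiGeneral, PowerSeries.coeff_mk]
  split_ifs
  · rw [aeval_hsymm_const, smul_smul, one_div, mul_comm, div_eq_mul_inv]
  · rfl

theorem phi_zero : phi 0 = 1 := by
  ext1 n
  rw [coeff_phi, if_pos (Nat.zero_le n), PowerSeries.coeff_one]
  rcases n with _ | n
  · simp
  · simp

/-- This is the recursion that splits h_{d+1} in `k + 1` variables by whether the last variable
occurs, here the Pascal rule for multiset coefficients. -/
theorem heat_phiXY (k : ℕ) :
    heat (phiXY (k + 1)) = fXY [bl] * phiXY (k + 1) + phiXY k := by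
  rw [phiXY, phiXY, fXY, ← map_mul, ← map_add, heat, mapDeriv_C]
  congr 1
  have hcut : mapDeriv cut (phi (k + 1)) = 0 := by
    ext1 n
    rw [coeff_mapDeriv, coeff_phi]
    split_ifs
    · rw [cut_eq_zero_of_mem (Subalgebra.smul_mem _ (pow_mem (fVar_mem _) _) _)]
      simp
    · simp
  rw [Derivation.sub_apply, hcut, sub_zero]
  ext1 n
  change PowerSeries.coeff n (PowerSeries.derivative Coeffs _) = _
  rw [PowerSeries.coeff_derivative, map_add, PowerSeries.coeff_C_mul, coeff_phi, coeff_phi,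
    coeff_phi]
  have hfac : (((n + 1).factorial : ℕ) : ℚ) = (n + 1) * n.factorial := by
    rw [Nat.factorial_succ]
    push_cast
    ring
  have hn : (n.factorial : ℚ) ≠ 0 := by positivity
  have hn1 : (n + 1 : ℚ) ≠ 0 := by positivity
  have hC : ((n : Coeffs) + 1) = MvPolynomial.C (n + 1 : ℚ) := by simp
  rw [hC, hfac]
  rcases lt_trichotomy n k with h | rfl | h
  · rw [if_neg (by omega), if_neg (by omega), if_neg (by omega)]
    simp
  · rw [if_pos le_rfl, if_neg (by omega), if_pos le_rfl]
    simp only [MvPolynomial.smul_eq_C_mul, Nat.sub_self, pow_zero, mul_one,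
      Nat.multichoose_zero_right, mul_zero, zero_add, ← map_mul]
    congr 1
    field_simp
  · obtain ⟨d, rfl⟩ : ∃ d, n = k + 1 + d := ⟨n - (k + 1), by omega⟩
    rw [if_pos (by omega), if_pos (by omega), if_pos (by omega),
      show k + 1 + d + 1 - (k + 1) = d + 1 by omega, show k + 1 + d - (k + 1) = d by omega,
      show k + 1 + d - k = d + 1 by omega, Nat.multichoose_succ_succ]
    simp only [MvPolynomial.smul_eq_C_mul]
    have e : ∀ a b : ℚ, ∀ p : Coeffs, MvPolynomial.C a * p + MvPolynomial.C b * p =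
      MvPolynomial.C (a + b) * p := fun a b p => by rw [map_add, add_mul]
    rw [mul_left_comm, ← pow_succ', e, mul_right_comm, ← map_mul]
    congr 2
    push_cast at hn1 ⊢
    field_simp
    ring

theorem phiXY_mem (k : ℕ) : phiXY k ∈ fSeries :=
  C_mem_coeffsIn fun n => by
    rw [coeff_phi]
    split_ifs
    · exact Subalgebra.smul_mem _ (pow_mem (fVar_mem _) _) _
    · exact zero_mem _

/-- The underlying fact is ∂φ_k/∂f_• = k φ_{k+1}. -/
theorem joinWithXY_phiXY (R : List Bool) (k : ℕ) :
    joinWithXY R (phiXY k) = k * (gXY (R ++ [bl, bl]) * phiXY (k + 1)) := by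
  have hk : (k : SeriesXY) = PowerSeries.C (PowerSeries.C (MvPolynomial.C (k : ℚ))) := by simp
  rw [hk, phiXY, phiXY, gXY, constXY, ← map_mul, ← map_mul, joinWithXY, mapDeriv_C]
  congr 1
  ext1 n
  rw [coeff_mapDeriv, PowerSeries.coeff_C_mul, PowerSeries.coeff_C_mul, coeff_phi, coeff_phi]
  rcases lt_trichotomy n k with h | rfl | h
  · rw [if_neg (by omega), if_neg (by omega)]
    simp
  · rw [if_pos le_rfl, if_neg (by omega)]
    simp
  · obtain ⟨d, rfl⟩ : ∃ d, n = k + 1 + d := ⟨n - (k + 1), by omega⟩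
    rw [if_pos (by omega), if_pos (by omega), show k + 1 + d - k = d + 1 by omega,
      show k + 1 + d - (k + 1) = d by omega, Derivation.map_smul, Derivation.leibniz_pow,
      joinWith_fVar_singleton]
    -- The absorption identity (d+1) C(k+d, d+1) = k C(k+d, d).
    have hmc : ((k.multichoose (d + 1) : ℕ) : ℚ) * (d + 1) = (k + 1).multichoose d * k := by
      have h1 := Nat.choose_succ_right_eq (k + d) d
      rw [Nat.multichoose_eq, Nat.multichoose_eq, show k + (d + 1) - 1 = k + d by omega,
        show k + 1 + d - 1 = k + d by omega]
      rw [show k + d - d = k by omega] at h1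
      exact_mod_cast h1
    simp only [MvPolynomial.smul_eq_C_mul, smul_eq_mul, nsmul_eq_mul, Nat.add_sub_cancel]
    have hd : ((d + 1 : ℕ) : Coeffs) = MvPolynomial.C (d + 1 : ℚ) := by simp
    have e1 : ∀ a b : ℚ, ∀ p q : Coeffs, MvPolynomial.C a * (MvPolynomial.C b * (p * q)) =
        MvPolynomial.C (a * b) * (q * p) := fun a b p q => by rw [map_mul]; ring
    have e2 : ∀ a b : ℚ, ∀ p q : Coeffs, MvPolynomial.C a * (p * (MvPolynomial.C b * q)) =
        MvPolynomial.C (a * b) * (p * q) := fun a b p q => by rw [map_mul]; ring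
    rw [hd, e1, e2]
    congr 2
    rw [div_mul_eq_mul_div, hmc]
    ring

end SeriesXY

/-! ### The dipole series -/

section DipoleSeries

theorem coeff_seriesB (k i j : ℕ) :
    PowerSeries.coeff j (PowerSeries.coeff i (PowerSeries.coeff k seriesB)) =
      (1 / ((i.factorial : ℚ) * (j.factorial : ℚ))) • coeffB k i j := by
  rw [seriesB, PowerSeries.coeff_mk, PowerSeries.coeff_mk, PowerSeries.coeff_mk]
  rfl

theorem coeff_seriesA (k i : ℕ) : PowerSeries.coeff i (PowerSeries.coeff k seriesA) =
    PowerSeries.C ((1 / (i.factorial : ℚ)) • (gVar [bl] * coeffA k i)) := by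
  rw [seriesA, PowerSeries.coeff_mk, PowerSeries.coeff_mk]
  rfl

theorem coeffA_mem (k n : ℕ) : coeffA k n ∈ fAlgebra :=
  sum_mem fun D _ => fMonomial_mem D.whiteWords

/-- The root word • is too short to be cut, and A does not involve y. -/
theorem heat_seriesA (k : ℕ) : heat (PowerSeries.coeff k seriesA) = 0 := by
  ext1 i
  ext1 j
  have hcut : cut ((1 / (i.factorial : ℚ)) • (gVar [bl] * coeffA k i)) = 0 := by
    rw [Derivation.map_smul, mul_comm, cut_mul_of_mem (coeffA_mem k i), cut_gVar]
    simp
  rw [coeff_heat, coeff_seriesA, PowerSeries.coeff_C, PowerSeries.coeff_C,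
    if_neg (Nat.succ_ne_zero j)]
  split_ifs
  · rw [hcut]
    simp
  · simp

theorem atZero_seriesB (k : ℕ) :
    atZero (PowerSeries.coeff k seriesB) = atZero (PowerSeries.coeff k seriesA) := by
  ext1 i
  rw [coeff_atZero, coeff_atZero, coeff_seriesB, coeff_seriesA, coeffB_beta_zero]
  simp

theorem coeff_heat_seriesB (k i j : ℕ) :
    PowerSeries.coeff j (PowerSeries.coeff i (heat (PowerSeries.coeff k seriesB))) =
      (1 / ((i.factorial : ℚ) * (j.factorial : ℚ))) • (coeffB k i (j + 1) -
        cut (coeffB k i j)) := by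
  rw [coeff_heat, coeff_seriesB, coeff_seriesB, Derivation.map_smul, smul_sub, smul_smul]
  congr 2
  rw [Nat.factorial_succ]
  push_cast
  field_simp

theorem heat_seriesB_zero : heat (PowerSeries.coeff 0 seriesB) = 0 := by
  ext1 i
  ext1 j
  rw [coeff_heat_seriesB, coeffB_zero_succ]
  simp

/-- The weight 1/j! turns passing from `j` to `j + 1` b-edges into ∂/∂y. The index rises by 2
because u records twice the genus. -/
theorem heat_seriesB (k : ℕ) :
    heat (PowerSeries.coeff (k + 2) seriesB) = joinXY (PowerSeries.coeff k seriesB) := by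
  ext1 i
  ext1 j
  rw [coeff_heat_seriesB, coeffB_succ, joinXY, PowerSeries.coeff_mk, PowerSeries.coeff_mk,
    coeff_seriesB, map_smul, add_sub_cancel_left]

/-! ### Explicit series on the sphere and the torus. -/

theorem xXY_mul_expXF : xXY * expXF = sumFrom 1 fun n => n := by
  ext1 n
  rw [expXF_eq_sumFrom, xXY]
  rcases n with _ | n
  · rw [coeff_sumFrom]
    simp
  · rw [PowerSeries.coeff_succ_X_mul, coeff_sumFrom, coeff_sumFrom, if_pos (Nat.zero_le _),
      if_pos (by omega)]
    congr 2
    rw [Nat.factorial_succ]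
    push_cast
    field_simp

theorem heat_expXF : heat expXF = 0 := by
  rw [expXF_eq_sumFrom, heat_sumFrom]

theorem expXF_mem : expXF ∈ fSeries := by
  rw [expXF_eq_sumFrom]
  exact sumFrom_mem _ _

theorem xXY_mem : xXY ∈ fSeries := X_mem_coeffsIn _

theorem joinWithXY_expXF (R : List Bool) :
    joinWithXY R expXF = gXY (R ++ [bl, wh]) * (xXY * expXF) := by
  rw [xXY_mul_expXF, expXF_eq_sumFrom, joinWithXY_sumFrom]
  simp

theorem seriesA_zero : PowerSeries.coeff 0 seriesA =
    gXY [bl] * sumFrom 0 fun n => if n = 0 then 0 else 1 := by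
  ext1 i
  rw [coeff_seriesA, gXY, constXY, PowerSeries.coeff_C_mul, coeff_sumFrom,
    if_pos (Nat.zero_le i), ← map_mul]
  congr 1
  rcases i with _ | i
  · simp [coeffA_edgeless]
  · rw [coeffA_zero (Nat.succ_pos i)]
    simp

theorem seriesA_two : PowerSeries.coeff 2 seriesA =
    gXY [bl] * (fXY [wh, wh, wh] * sumFrom 3 (fun n => psi3 n) +
      fXY [wh, wh] ^ 2 * sumFrom 4 (fun n => psi22 n)) := by
  ext1 i
  rw [coeff_seriesA, gXY, constXY, PowerSeries.coeff_C_mul, map_add, fXY, fXY, ← map_pow,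
    PowerSeries.coeff_C_mul, PowerSeries.coeff_C_mul, ← map_pow, coeff_sumFrom, coeff_sumFrom,
    coeffA_two]
  rw [show (0 : SeriesY) = PowerSeries.C (0 : Coeffs) by simp, ← apply_ite PowerSeries.C,
    ← apply_ite PowerSeries.C, ← map_mul, ← map_mul, ← map_add, ← map_mul]
  congr 1
  rw [← mul_smul_comm, smul_add]
  congr 2
  · split_ifs
    · rw [smul_smul, mul_smul_comm, one_div_mul_eq_div]
    · simp
  · split_ifs
    · rw [smul_smul, mul_smul_comm, one_div_mul_eq_div]
    · simp

theorem seriesB_zero : PowerSeries.coeff 0 seriesB = PowerSeries.coeff 0 seriesA :=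
  eq_of_heat_eq (heat_seriesB_zero.trans (heat_seriesA 0).symm) (atZero_seriesB 0)

theorem joinXY_seriesB_zero :
    joinXY (PowerSeries.coeff 0 seriesB) = gXY [bl, bl, wh] * (xXY * expXF) := by
  rw [seriesB_zero, seriesA_zero, joinXY_gXY_mul _ (sumFrom_mem _ _), joinWithXY_sumFrom,
    xXY_mul_expXF]
  congr 1
  ext1 n
  rw [coeff_sumFrom, coeff_sumFrom]
  -- The missing constant term of A^{(0)} (there is no edgeless dipole) is invisible after
  -- differentiating by f_∘.
  rcases n with _ | n <;> simp

theorem phiXY_zero : phiXY 0 = 1 := by simp [phiXY, phi_zero]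

/-- The genus 0 source is g_{••∘} times x exp(x f_∘), which is constant for ∂/∂y − C'; τ_{•∘,0}
integrates g_{••∘}. -/
theorem seriesB_two : PowerSeries.coeff 2 seriesB =
    xXY * expXF * tauXY [bl, wh] 0 + PowerSeries.coeff 2 seriesA := by
  refine eq_of_heat_eq ?_ ?_
  · rw [heat_seriesB, joinXY_seriesB_zero, map_add, heat_seriesA, Derivation.leibniz,
      Derivation.leibniz, heat_tauXY, heat_xXY, heat_expXF, phiXY_zero]
    simp only [smul_eq_mul]
    ring
  · rw [atZero_seriesB, map_add, map_mul, atZero_tauXY, mul_zero, zero_add]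

theorem heat_gXY (R : List Bool) : heat (gXY R) = -constXY (cut (gVar R)) := heat_constXY _

theorem atZero_phiXY_succ (k : ℕ) : atZero (phiXY (k + 1)) = 0 := by
  rw [phiXY, atZero, PowerSeries.map_C, ← PowerSeries.coeff_zero_eq_constantCoeff_apply, coeff_phi,
    if_neg (by omega), map_zero]

/-- A closed form is needed because `join` must be applied to τ_{•∘,0}. Here C' closes up on g_{••∘}
and g_{••}: it gives g_{••∘} f_• + g_{••} f_{(•∘)} and g_{••} f_•. The resulting triangular system
is solved by φ_1 and φ_2. -/
theorem tauXY_black_white : tauXY [bl, wh] 0 =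
    gXY [bl, bl, wh] * phiXY 1 + gXY [bl, bl] * fXY [bl, wh] * phiXY 2 := by
  have h1 : heat (gXY [bl, bl, wh]) =
      -(gXY [bl, bl] * fXY [bl, wh] + gXY [bl, bl, wh] * fXY [bl]) := by
    rw [heat_gXY, cut_gVar]
    simp [Finset.sum_Icc_succ_top, constXY, gXY, fXY]
  have h2 : heat (gXY [bl, bl]) = -(gXY [bl, bl] * fXY [bl]) := by
    rw [heat_gXY, cut_gVar]
    simp [constXY, gXY, fXY]
  refine eq_of_heat_eq ?_ ?_
  · rw [heat_tauXY, map_add, Derivation.leibniz, Derivation.leibniz, Derivation.leibniz, h1, h2,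
      heat_fXY, heat_phiXY, heat_phiXY, phiXY_zero]
    simp only [smul_eq_mul]
    ring
  · rw [atZero_tauXY, map_add, map_mul, map_mul, atZero_phiXY_succ, atZero_phiXY_succ]
    simp

/-- The product rule in the f's, applied to the three root words ••∘, •• and •. The factor 3 counts
the rotations of ∘∘∘, the 4 comes from differentiating f_{(∘∘)}² with two rotations of ∘∘, and the 2
comes from ∂φ_2/∂f_•. Factors φ_0 = 1 are kept so that every term has the shape of a source of some
τ. -/
theorem joinXY_seriesB_two : joinXY (PowerSeries.coeff 2 seriesB) =
    xXY * expXF * (gXY [bl, bl, wh, bl, bl] * phiXY 2 + xXY * (gXY [bl, bl, wh, bl, wh] * phiXY 1)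
      + 2 * fXY [bl, wh] * (gXY [bl, bl, bl, bl] * phiXY 3) + gXY [bl, bl, bl, bl, wh] * phiXY 2
      + gXY [bl, bl, bl, wh, bl] * phiXY 2
      + xXY * fXY [bl, wh] * (gXY [bl, bl, bl, wh] * phiXY 2))
    + 3 * (gXY [bl, bl, wh, wh, wh] * phiXY 0) * sumFrom 3 (fun n => psi3 n)
    + gXY [bl, bl, wh] * phiXY 0 * fXY [wh, wh, wh] * sumFrom 4 (fun n => (n - 3) * psi3 n)
    + 4 * (gXY [bl, bl, wh, wh] * phiXY 0) * fXY [wh, wh] * sumFrom 4 (fun n => psi22 n)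
    + gXY [bl, bl, wh] * phiXY 0 * fXY [wh, wh] ^ 2 * sumFrom 5 (fun n => (n - 4) * psi22 n) := by
  have hB : PowerSeries.coeff 2 seriesB = gXY [bl, bl, wh] * (xXY * expXF * phiXY 1) +
      gXY [bl, bl] * (xXY * expXF * fXY [bl, wh] * phiXY 2) +
      gXY [bl] * (fXY [wh, wh, wh] * sumFrom 3 (fun n => psi3 n) +
        fXY [wh, wh] ^ 2 * sumFrom 4 (fun n => psi22 n)) := by
    rw [seriesB_two, tauXY_black_white, seriesA_two]
    ring
  have hxE := mul_mem xXY_mem expXF_mem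
  have d1 : ∀ R, joinWithXY R (fXY [bl, wh]) = gXY (R ++ [bl, bl, wh]) + gXY (R ++ [bl, wh, bl]) := by
    intro R
    rw [joinWithXY_fXY, sum_lists (by simp)]
    simp [Finset.sum_range_succ, constXY, gXY, add_comm]
  have d2 : ∀ R, joinWithXY R (fXY [wh, wh]) = 2 * gXY (R ++ [bl, wh, wh]) := by
    intro R
    rw [joinWithXY_fXY, sum_lists (by simp)]
    simp [Finset.sum_range_succ, constXY, gXY, two_mul]
  have d3 : ∀ R, joinWithXY R (fXY [wh, wh, wh]) = 3 * gXY (R ++ [bl, wh, wh, wh]) := by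
    intro R
    rw [joinWithXY_fXY, sum_lists (by simp)]
    simp [Finset.sum_range_succ, constXY, gXY]
    ring
  rw [hB, joinXY_add, joinXY_add, joinXY_gXY_mul _ (mul_mem hxE (phiXY_mem _)),
    joinXY_gXY_mul _ (mul_mem (mul_mem hxE (fXY_mem _)) (phiXY_mem _)),
    joinXY_gXY_mul _ (add_mem (mul_mem (fXY_mem _) (sumFrom_mem _ _))
      (mul_mem (pow_mem (fXY_mem _) _) (sumFrom_mem _ _)))]
  simp only [map_add, Derivation.leibniz, Derivation.leibniz_pow, joinWithXY_xXY,
    joinWithXY_expXF, joinWithXY_phiXY, joinWithXY_sumFrom, d1, d2, d3, smul_eq_mul, nsmul_eq_mul,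
    phiXY_zero, List.cons_append, List.nil_append]
  push_cast
  ring

end DipoleSeries

end DipoleSeries

/-! ### Integration on the double torus. -/

open DipoleSeries
theorem mainTheorem8 :
    PowerSeries.coeff 4 seriesB =
      xXY * expXF *
        (tauXY [bl, wh, bl, bl] 2 + xXY * tauXY [bl, wh, bl, wh] 1 + 2 * fXY [bl, wh] * tauXY [bl, bl, bl] 3
          + tauXY [bl, bl, bl, wh] 2 + tauXY [bl, bl, wh, bl] 2 + xXY * fXY [bl, wh] * tauXY [bl, bl, wh] 2)
      + 3 * tauXY [bl, wh, wh, wh] 0 * sumFrom 3 (fun n => psi3 n)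
      + tauXY [bl, wh] 0 * fXY [wh, wh, wh] * sumFrom 4 (fun n => (n - 3) * psi3 n)
      + 4 * tauXY [bl, wh, wh] 0 * fXY [wh, wh] * sumFrom 4 (fun n => psi22 n)
      + tauXY [bl, wh] 0 * fXY [wh, wh] ^ 2 * sumFrom 5 (fun n => (n - 4) * psi22 n)
      + PowerSeries.coeff 4 seriesA := by
  refine eq_of_heat_eq ?_ ?_
  · have c2 : heat 2 = 0 := heat.map_natCast 2
    have c3 : heat 3 = 0 := heat.map_natCast 3
    have c4 : heat 4 = 0 := heat.map_natCast 4
    -- Every factor other than a τ is annihilated by ∂/∂y − C', so the right-hand side reproduces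
    -- the source term by term.
    rw [heat_seriesB 2, joinXY_seriesB_two]
    simp only [map_add, Derivation.leibniz, Derivation.leibniz_pow, heat_seriesA, heat_tauXY,
      heat_fXY, heat_sumFrom, heat_xXY, heat_expXF, c2, c3, c4, smul_eq_mul, smul_zero, mul_zero,
      add_zero, zero_add]
    ring
  -- At y = 0 every τ vanishes, and only the initial value A^{(2)} remains.
  · rw [atZero_seriesB]
    simp only [map_add, map_mul, atZero_tauXY, mul_zero, zero_mul, add_zero, zero_add]
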